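/- Throughout, $\log$ is the base-2 logarithm. Consider a finite game with $m$ players in which player $i\in\{1,\dots,m\}$ has $n_i\ge 1$ actions $\mathcal A_i=\{1,\dots,n_i\}$ and an arbitrary loss function $\mathcal L_i:\mathcal A_1\times\dots\times\mathcal A_m\to[0,1]$. When the players use mixed strategies $x_1^{t},\dots,x_m^{t}$ in round $t\ge 1$, the loss vector of player $i$ is $\ell_i^{t}(j)=\mathbb E_{a_{-i}\sim x_{-i}^{t}}[\mathcal L_i(j,a_{-i})]$; set $\ell_i^{0}=0$. The regret of player $i$ after $T$ rounds is $$\mathrm{Reg}_{i,T}=\sum_{t=1}^T\sum_{j=1}^{n_i} x_i^{t}(j)\,\ell_i^{t}(j)-\min_{1\le j\le n_i}\sum_{t=1}^T\ell_i^{t}(j).$$ All players play Optimistic Hedge with step size $\eta$ if, for every $i$, $x_i^{1}$ is uniform on $\mathcal A_i$ and, for $1\le t<T$ and all $j$, $$x_i^{t+1}(j)=\frac{x_i^{t}(j)\exp\!\big(-\eta(2\ell_i^{t}(j)-\ell_i^{t-1}(j))\big)}{\sum_{k=1}^{n_i}x_i^{t}(k)\exp\!\big(-\eta(2\ell_i^{t}(k)-\ell_i^{t-1}(k))\big)}.$$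 **Theorem.** There are absolute constants $C,C'>1$ and $K>0$ such that for every number of players $m\ge 1$, every such game, and every time horizon $T\ge 2$ the following hold. 1. If all players play Optimistic Hedge with a step size $0<\eta\le \frac{1}{C\,m\log^4T}$, then for every player $i$ $$\mathrm{Reg}_{i,T}\le\frac{\log n_i}{\eta}+C'\log T.$$ 2. If all players play Optimistic Hedge with step size $\eta=\frac{1}{C\,m\log^4T}$, then for every player $i$ $$\mathrm{Reg}_{i,T}\le K\,m\,\log n_i\,\log^4T .$$ 3. Under the assumption of 2, if $n_i\le n$ for every $i$, then the empirical distribution of play $\sigma=\frac1T\sum_{t=1}^T x_1^{t}\times\dots\times x_m^{t}$ is a $\frac{K\,m\log n\,\log^4T}{T}$-approximate coarse correlated equilibrium, where $\sigma$ is an $\varepsilon$-approximate coarse correlated equilibrium if it is a probability distribution on $\mathcal A_1\times\dots\times\mathcal A_m$ such that for every player $i$ and every action $j\in\mathcal A_i$ $$\mathbb E_{a\sim\sigma}[\mathcal L_i(a)]\le\mathbb E_{a\sim\sigma}[\mathcal L_i(j,a_{-i})]+\varepsilon .$$ -/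

import Mathlib

open Finset

noncomputable section

namespace OptHedge

/-- A finite general-sum game with `m` players, where player `i` has the actions `Fin (n i)` and a
loss function on action profiles with values in `[0, 1]`. -/
structure Game (m : ℕ) (n : Fin m → ℕ) where
  loss : Fin m → (∀ k, Fin (n k)) → ℝ
  loss_mem : ∀ i a, loss i a ∈ Set.Icc (0 : ℝ) 1

variable {m : ℕ} {n : Fin m → ℕ}

/-- Expected loss of player `i` for the action `j` when the others independently use the mixed
strategies `x k`, `k ≠ i`. Profiles `a` with `a i = j` correspond to the choices of `a_{-i}`. -/
def Game.expectedLoss (G : Game m n) (x : ∀ k, Fin (n k) → ℝ) (i : Fin m) (j : Fin (n i)) : ℝ :=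
  ∑ a : (∀ k, Fin (n k)) with a i = j, (∏ k ∈ univ.erase i, x k (a k)) * G.loss i a

/-- The loss vector `ℓ_i^t` of player `i` in round `t ≥ 1` when play in round `t` is `x t`;
by convention `ℓ_i^0 = 0`. -/
def Game.lossVector (G : Game m n) (x : ℕ → ∀ k, Fin (n k) → ℝ) (i : Fin m) (t : ℕ) :
    Fin (n i) → ℝ :=
  if t = 0 then 0 else G.expectedLoss (x t) i

/-- The strategies `y 1, …, y T` are those that Optimistic Hedge with step size `η` chooses
against the loss vectors `l 1, l 2, …` (with `l 0` as the loss vector of round `0`).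
The value `y 0` plays no role. -/
structure IsOptimisticHedge {N : ℕ} (η : ℝ) (T : ℕ) (l y : ℕ → Fin N → ℝ) : Prop where
  init : ∀ j, y 1 j = 1 / (N : ℝ)
  step : ∀ t, 1 ≤ t → t < T → ∀ j,
    y (t + 1) j = y t j * Real.exp (-η * (2 * l t j - l (t - 1) j)) /
      ∑ k, y t k * Real.exp (-η * (2 * l t k - l (t - 1) k))

/-- All players of `G` play according to Optimistic Hedge with step size `η` for `T` rounds. -/
def Game.AllPlayOptimisticHedge (G : Game m n) (η : ℝ) (T : ℕ)
    (x : ℕ → ∀ k, Fin (n k) → ℝ) : Prop :=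
  ∀ i, IsOptimisticHedge η T (G.lossVector x i) (fun t => x t i)

/-- The regret of player `i` over the rounds `1, …, T`. -/
def Game.regret (G : Game m n) (x : ℕ → ∀ k, Fin (n k) → ℝ) (i : Fin m) (T : ℕ) : ℝ :=
  ∑ t ∈ Icc 1 T, ∑ j, x t i j * G.lossVector x i t j -
    ⨅ j, ∑ t ∈ Icc 1 T, G.lossVector x i t j

/-- The empirical distribution of play over the rounds `1, …, T`: the average over `t` of the
product distributions `x_1^t × ⋯ × x_m^t` on action profiles. -/
def empiricalPlay (x : ℕ → ∀ k, Fin (n k) → ℝ) (T : ℕ) (a : ∀ k, Fin (n k)) : ℝ :=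
  (1 / (T : ℝ)) * ∑ t ∈ Icc 1 T, ∏ k, x t k (a k)

/-- `σ` is an `ε`-approximate coarse correlated equilibrium: a distribution on action profiles
such that no player can lower her expected loss by more than `ε` by committing to a fixed action
while the others follow `σ`. -/
def Game.IsApproxCCE (G : Game m n) (ε : ℝ) (σ : (∀ k, Fin (n k)) → ℝ) : Prop :=
  σ ∈ stdSimplex ℝ (∀ k, Fin (n k)) ∧
    ∀ (i : Fin m) (j : Fin (n i)),
      ∑ a, σ a * G.loss i a ≤ ∑ a, σ a * G.loss i (Function.update a i j) + ε

end OptHedge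

end

/-! Write `y t` for a player's strategy and `l t` for her loss vector in round t. Comparing the
unnormalised weights of ordinary Hedge before and after round t expresses the change of the
log-potential through two log moment generating functions under `y t`. Expanding both to second
order gives regret ≤ log n / η + η Σ_t (3/5 Var(l t − l (t−1)) − 2/5 Var(l (t−1))). It therefore
suffices that the total variance of the first differences of the losses is a small fraction of the
total variance of the losses, up to O(log T).

This follows from smoothness at all orders up to about log T. The losses are polynomials in the
strategies, and the strategies are softmaxes of cumulative losses times η. `diffNorm` is a
submultiplicative norm controlling iterated differences, so exponentials, inverses and products are
estimated as in a Banach algebra; strong induction on the order h gives |Δ^h l| ≤ 2 h!/ρ^h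
(`abs_fwdDiff_iter_lossVector_le`). With ρ = 8(H+1), H = ⌈log T⌉ and h ≤ H+1 this is at most
2·8^(−h).

Let A_h be the sum over rounds of the variances of the h-th differences. Summation by parts and
AM–GM bound A_{h+1} by κ/2·A_h + A_{h+2}/(2κ) up to boundary terms and drift of the weights, an
approximate log-convexity. Since A_{H+1} is tiny, descending induction carries a ratio of about 1/32
down to A_1 ≤ 3/32·A_0 + 312 (`energy_ratio_le`). As 3/5·3/32 < 2/5, the negative variances in the
regret bound win. -/

section DiffNorm



/-! ### A submultiplicative norm for iterated differences -/

/-- Leibniz rule for iterated forward differences. -/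
theorem fwdDiff_iter_mul (f g : ℕ → ℝ) (n : ℕ) : ∀ s : ℕ,
    (fwdDiff 1)^[n] (f * g) s =
      ∑ p ∈ antidiagonal n, (n.choose p.1 : ℝ) *
        ((fwdDiff 1)^[p.1] f (s + p.2) * (fwdDiff 1)^[p.2] g s) := by
  induction n with
  | zero => intro s; simp
  | succ n ih =>
    intro s
    rw [sum_antidiagonal_choose_succ_mul
      (fun i j => (fwdDiff 1)^[i] f (s + j) * (fwdDiff 1)^[j] g s) n, Function.iterate_succ_apply']
    rw [fwdDiff, ih, ih, ← sum_sub_distrib, ← sum_add_distrib]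
    refine sum_congr rfl fun p hp => ?_
    have hc : n.choose p.2 = n.choose p.1 := by
      rw [← HasAntidiagonal.mem_antidiagonal.1 hp]; exact Nat.choose_symm_add.symm
    simp only [Function.iterate_succ_apply', fwdDiff, hc]
    rw [show s + 1 + p.2 = s + p.2 + 1 by ring, show s + (p.2 + 1) = s + p.2 + 1 by ring]
    ring

/-- The largest value of `|Δ^k f|` whose evaluation only uses the values of `f` on `0, …, h`. -/
noncomputable def diffSup (h k : ℕ) (f : ℕ → ℝ) : ℝ :=
  (range (h - k + 1)).sup' nonempty_range_add_one fun s => |(fwdDiff 1)^[k] f s|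

/-- A submultiplicative norm for finite sequences `f 0, …, f h` that controls all their iterated
forward differences. -/
noncomputable def diffNorm (ρ : ℝ) (h : ℕ) (f : ℕ → ℝ) : ℝ :=
  ∑ k ∈ range (h + 1), ρ ^ k / (k.factorial : ℝ) * diffSup h k f

theorem abs_le_diffSup {h k s : ℕ} (f : ℕ → ℝ) (hs : s + k ≤ h) :
    |(fwdDiff 1)^[k] f s| ≤ diffSup h k f :=
  le_sup' (fun s => |(fwdDiff 1)^[k] f s|) (mem_range.2 (by omega))

theorem diffSup_le {h k : ℕ} {f : ℕ → ℝ} {c : ℝ} (hk : k ≤ h)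
    (H : ∀ s, s + k ≤ h → |(fwdDiff 1)^[k] f s| ≤ c) : diffSup h k f ≤ c :=
  sup'_le _ _ fun s hs => H s (by have := mem_range.1 hs; omega)

theorem diffSup_nonneg (h k : ℕ) (f : ℕ → ℝ) : 0 ≤ diffSup h k f :=
  (abs_nonneg _).trans (le_sup' (fun s => |(fwdDiff 1)^[k] f s|) (mem_range.2 (Nat.succ_pos _)))

theorem diffNorm_nonneg {ρ : ℝ} (hρ : 0 ≤ ρ) (h : ℕ) (f : ℕ → ℝ) : 0 ≤ diffNorm ρ h f :=
  sum_nonneg fun k _ => mul_nonneg (by positivity) (diffSup_nonneg h k f)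

theorem fwdDiff_iter_congr {f g : ℕ → ℝ} (k : ℕ) : ∀ s,
    (∀ r, s ≤ r → r ≤ s + k → f r = g r) → (fwdDiff 1)^[k] f s = (fwdDiff 1)^[k] g s := by
  induction k with
  | zero => intro s H; simpa using H s le_rfl (by simp)
  | succ k ih =>
    intro s H
    simp only [Function.iterate_succ_apply', fwdDiff]
    rw [ih s fun r h1 h2 => H r h1 (by omega), ih (s + 1) fun r h1 h2 => H r (by omega) (by omega)]

theorem diffSup_congr {h : ℕ} {f g : ℕ → ℝ} (H : ∀ s ≤ h, f s = g s) {k : ℕ} (hk : k ≤ h) :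
    diffSup h k f = diffSup h k g :=
  sup'_congr _ rfl fun s hs => by
    rw [fwdDiff_iter_congr k s fun r _ h2 => H r (by have := mem_range.1 hs; omega)]

theorem diffNorm_congr {ρ : ℝ} {h : ℕ} {f g : ℕ → ℝ} (H : ∀ s ≤ h, f s = g s) :
    diffNorm ρ h f = diffNorm ρ h g :=
  sum_congr rfl fun k hk => by rw [diffSup_congr H (by have := mem_range.1 hk; omega)]

theorem diffNorm_add_le {ρ : ℝ} (hρ : 0 ≤ ρ) (h : ℕ) (f g : ℕ → ℝ) :
    diffNorm ρ h (f + g) ≤ diffNorm ρ h f + diffNorm ρ h g := by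
  unfold diffNorm
  rw [← sum_add_distrib]
  refine sum_le_sum fun k hk => ?_
  rw [← mul_add]
  refine mul_le_mul_of_nonneg_left ?_ (by positivity)
  refine diffSup_le (by have := mem_range.1 hk; omega) fun s hs => ?_
  rw [fwdDiff_iter_add]
  exact (abs_add_le _ _).trans (add_le_add (abs_le_diffSup f hs) (abs_le_diffSup g hs))

theorem diffNorm_smul {ρ : ℝ} (h : ℕ) (c : ℝ) (f : ℕ → ℝ) :
    diffNorm ρ h (c • f) = |c| * diffNorm ρ h f := by
  unfold diffNorm
  rw [mul_sum]
  refine sum_congr rfl fun k _ => ?_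
  have : diffSup h k (c • f) = |c| * diffSup h k f := by
    unfold diffSup
    rw [mul₀_sup' (abs_nonneg c)]
    refine sup'_congr _ rfl fun s _ => ?_
    rw [fwdDiff_iter_const_smul, Pi.smul_apply, smul_eq_mul, abs_mul]
  rw [this]; ring

theorem diffNorm_zero (ρ : ℝ) (h : ℕ) : diffNorm ρ h 0 = 0 := by
  simpa using diffNorm_smul (ρ := ρ) h 0 0

theorem diffNorm_neg (ρ : ℝ) (h : ℕ) (f : ℕ → ℝ) : diffNorm ρ h (-f) = diffNorm ρ h f := by
  simpa using diffNorm_smul (ρ := ρ) h (-1) f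

theorem diffNorm_one_le (ρ : ℝ) (h : ℕ) : diffNorm ρ h 1 ≤ 1 := by
  unfold diffNorm
  rw [sum_eq_single_of_mem 0 (by simp)]
  · simp only [pow_zero, Nat.factorial_zero, Nat.cast_one, div_one, one_mul]
    exact diffSup_le (Nat.zero_le _) (by simp)
  · intro k hk hk0
    obtain ⟨k, rfl⟩ := Nat.exists_eq_succ_of_ne_zero hk0
    have h0 : (fwdDiff 1)^[k + 1] (1 : ℕ → ℝ) = 0 := by
      rw [Function.iterate_succ_apply,
        show fwdDiff 1 (1 : ℕ → ℝ) = (0 : ℝ) • (0 : ℕ → ℝ) by ext; simp [fwdDiff],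
        fwdDiff_iter_const_smul, zero_smul]
    have : diffSup h (k + 1) 1 = 0 := le_antisymm
      (diffSup_le (by have := mem_range.1 hk; omega) fun s _ => by simp [h0])
      (diffSup_nonneg _ _ _)
    simp [this]

theorem diffNorm_sum_le {ρ : ℝ} (hρ : 0 ≤ ρ) (h : ℕ) {ι : Type*} (s : Finset ι)
    (f : ι → ℕ → ℝ) : diffNorm ρ h (∑ i ∈ s, f i) ≤ ∑ i ∈ s, diffNorm ρ h (f i) := by
  classical
  induction s using Finset.induction_on with
  | empty => simp [diffNorm_zero]
  | insert a s ha ih =>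
    rw [sum_insert ha, sum_insert ha]
    exact (diffNorm_add_le hρ h _ _).trans (by gcongr)

theorem diffSup_mul_le {h n : ℕ} (hn : n ≤ h) (f g : ℕ → ℝ) :
    diffSup h n (f * g) ≤
      ∑ p ∈ antidiagonal n, (n.choose p.1 : ℝ) * (diffSup h p.1 f * diffSup h p.2 g) := by
  refine diffSup_le hn fun s hs => ?_
  rw [fwdDiff_iter_mul]
  refine (abs_sum_le_sum_abs _ _).trans (sum_le_sum fun p hp => ?_)
  have := HasAntidiagonal.mem_antidiagonal.1 hp
  rw [abs_mul, abs_mul, Nat.abs_cast]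
  exact mul_le_mul_of_nonneg_left (mul_le_mul (abs_le_diffSup f (by omega))
    (abs_le_diffSup g (by omega)) (abs_nonneg _) (diffSup_nonneg _ _ _)) (Nat.cast_nonneg _)

/-- The weights ρ^k/k! absorb the binomial coefficients of the Leibniz rule, so the bound becomes a
Cauchy product truncated to a triangle. Enlarging the triangle to a square only adds nonnegative
terms. -/
theorem diffNorm_mul_le {ρ : ℝ} (hρ : 0 ≤ ρ) (h : ℕ) (f g : ℕ → ℝ) :
    diffNorm ρ h (f * g) ≤ diffNorm ρ h f * diffNorm ρ h g := by
  set a : ℕ → ℝ := fun k => ρ ^ k / (k.factorial : ℝ) * diffSup h k f with ha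
  set b : ℕ → ℝ := fun k => ρ ^ k / (k.factorial : ℝ) * diffSup h k g with hb
  have ha0 : ∀ k, 0 ≤ a k := fun k => mul_nonneg (by positivity) (diffSup_nonneg h k f)
  have hb0 : ∀ k, 0 ≤ b k := fun k => mul_nonneg (by positivity) (diffSup_nonneg h k g)
  calc diffNorm ρ h (f * g)
      ≤ ∑ n ∈ range (h + 1), ∑ p ∈ antidiagonal n, a p.1 * b p.2 := by
        refine sum_le_sum fun n hn => ?_
        refine (mul_le_mul_of_nonneg_left (diffSup_mul_le (by have := mem_range.1 hn; omega) f g)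
          (by positivity)).trans_eq ?_
        rw [mul_sum]
        refine sum_congr rfl fun p hp => ?_
        have hp' := HasAntidiagonal.mem_antidiagonal.1 hp
        subst hp'
        have h1 : ((p.1 + p.2).choose p.1 : ℝ) * (p.1.factorial * p.2.factorial) =
            (p.1 + p.2).factorial := by
          have := Nat.add_choose_mul_factorial_mul_factorial p.1 p.2
          rw [← Nat.choose_symm_add] at this
          rw [← mul_assoc]; exact_mod_cast this
        have h2 : ((p.1 + p.2).factorial : ℝ) ≠ 0 := by positivity
        have h3 : (p.1.factorial : ℝ) ≠ 0 := by positivity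
        have h4 : (p.2.factorial : ℝ) ≠ 0 := by positivity
        simp only [ha, hb]
        rw [pow_add]
        field_simp
        rw [← h1]; ring
    _ = ∑ p ∈ (range (h + 1)).sigma (fun n => antidiagonal n), a p.2.1 * b p.2.2 := by
        rw [sum_sigma]
    _ ≤ ∑ q ∈ range (h + 1) ×ˢ range (h + 1), a q.1 * b q.2 := by
        rw [← sum_image (s := (range (h + 1)).sigma (fun n => antidiagonal n))
          (g := fun p : (_ : ℕ) × ℕ × ℕ => p.2) (f := fun q : ℕ × ℕ => a q.1 * b q.2)]
        · refine sum_le_sum_of_subset_of_nonneg ?_ fun q _ _ => mul_nonneg (ha0 _) (hb0 _)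
          intro q hq
          obtain ⟨p, hp, rfl⟩ := mem_image.1 hq
          simp only [mem_sigma, mem_range, HasAntidiagonal.mem_antidiagonal] at hp
          simp only [mem_product, mem_range]
          omega
        · rintro ⟨n, p⟩ hp ⟨n', p'⟩ hp' heq
          simp only [coe_sigma, Set.mem_sigma_iff, mem_coe, HasAntidiagonal.mem_antidiagonal] at hp hp'
          simp only at heq
          obtain rfl := heq
          obtain rfl : n = n' := by rw [← hp.2, ← hp'.2]
          rfl
    _ = diffNorm ρ h f * diffNorm ρ h g := by
        rw [sum_product, diffNorm, diffNorm, sum_mul_sum]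

theorem diffNorm_prod_le {ρ : ℝ} (hρ : 0 ≤ ρ) (h : ℕ) {ι : Type*} (s : Finset ι)
    (f : ι → ℕ → ℝ) : diffNorm ρ h (∏ i ∈ s, f i) ≤ ∏ i ∈ s, diffNorm ρ h (f i) := by
  classical
  induction s using Finset.induction_on with
  | empty => simpa using diffNorm_one_le ρ h
  | insert a s ha ih =>
    rw [prod_insert ha, prod_insert ha]
    exact (diffNorm_mul_le hρ h _ _).trans
      (mul_le_mul_of_nonneg_left ih (diffNorm_nonneg hρ h _))

theorem diffNorm_pow_le {ρ : ℝ} (hρ : 0 ≤ ρ) (h : ℕ) (f : ℕ → ℝ) (n : ℕ) :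
    diffNorm ρ h (f ^ n) ≤ diffNorm ρ h f ^ n := by
  simpa using diffNorm_prod_le hρ h (range n) fun _ => f

theorem continuous_fwdDiff_iter (k : ℕ) : ∀ s : ℕ,
    Continuous fun f : ℕ → ℝ => (fwdDiff 1)^[k] f s := by
  induction k with
  | zero => intro s; exact continuous_apply s
  | succ k ih =>
    intro s
    simp only [Function.iterate_succ_apply', fwdDiff]
    exact (ih _).sub (ih _)

theorem continuous_diffNorm (ρ : ℝ) (h : ℕ) : Continuous (diffNorm ρ h) := by
  unfold diffNorm diffSup
  refine continuous_finsetSum _ fun k _ => continuous_const.mul ?_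
  exact Continuous.finset_sup'_apply _ fun s _ => (continuous_fwdDiff_iter k s).abs

/-- Bound the power series termwise and pass to the limit: the norm involves finitely many values,
so it is continuous for pointwise convergence. Removing the constant term makes the bound small for
small `u`, as the inversion of the softmax denominator requires. -/
theorem diffNorm_exp_sub_one_le {ρ : ℝ} (hρ : 0 ≤ ρ) (h : ℕ) (u : ℕ → ℝ) :
    diffNorm ρ h (fun s => Real.exp (u s) - 1) ≤ Real.exp (diffNorm ρ h u) - 1 := by
  have hser : ∀ y : ℝ, Filter.Tendsto
      (fun K : ℕ => ∑ k ∈ range K, y ^ (k + 1) / ((k + 1).factorial : ℝ)) Filter.atTop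
      (nhds (Real.exp y - 1)) := by
    intro y
    have h1 : HasSum (fun k : ℕ => y ^ k / (k.factorial : ℝ)) (Real.exp y) := by
      rw [Real.exp_eq_exp_ℝ]; exact NormedSpace.expSeries_div_hasSum_exp y
    have h2 := (hasSum_nat_add_iff' 1).2 h1
    simpa using h2.tendsto_sum_nat
  have hlim : Filter.Tendsto (fun K : ℕ => (∑ k ∈ range K,
      ((k + 1).factorial : ℝ)⁻¹ • u ^ (k + 1) : ℕ → ℝ)) Filter.atTop
      (nhds fun s => Real.exp (u s) - 1) := by
    rw [tendsto_pi_nhds]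
    intro s
    refine (hser (u s)).congr fun K => ?_
    simp [Finset.sum_apply, div_eq_inv_mul]
  refine le_of_tendsto_of_tendsto' (((continuous_diffNorm ρ h).tendsto _).comp hlim)
    (hser (diffNorm ρ h u)) fun K => ?_
  refine (diffNorm_sum_le hρ h _ _).trans (sum_le_sum fun k _ => ?_)
  rw [diffNorm_smul, abs_of_nonneg (by positivity), div_eq_inv_mul]
  exact mul_le_mul_of_nonneg_left (diffNorm_pow_le hρ h u _) (by positivity)

theorem diffNorm_exp_le {ρ : ℝ} (hρ : 0 ≤ ρ) (h : ℕ) (u : ℕ → ℝ) :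
    diffNorm ρ h (fun s => Real.exp (u s)) ≤ Real.exp (diffNorm ρ h u) := by
  have h1 := diffNorm_add_le hρ h 1 (fun s => Real.exp (u s) - 1)
  rw [show (1 : ℕ → ℝ) + (fun s => Real.exp (u s) - 1) = fun s => Real.exp (u s) by
    ext s; simp] at h1
  linarith [diffNorm_one_le ρ h, diffNorm_exp_sub_one_le hρ h u]

/-- A Neumann argument without the series: take norms in Z⁻¹ = 1 − (Z − 1) Z⁻¹ and absorb the last
term, which is possible because the norm of Z⁻¹ is finite and q < 1. -/
theorem diffNorm_inv_le {ρ q : ℝ} (hρ : 0 ≤ ρ) (h : ℕ) {Z : ℕ → ℝ} (hZ : ∀ s, Z s ≠ 0)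
    (hq : diffNorm ρ h (Z - 1) ≤ q) (hq1 : q < 1) :
    diffNorm ρ h (fun s => (Z s)⁻¹) ≤ 1 / (1 - q) := by
  have heq : (fun s => (Z s)⁻¹) = 1 + -((Z - 1) * fun s => (Z s)⁻¹) := by
    ext s
    have := hZ s
    simp only [Pi.add_apply, Pi.one_apply, Pi.neg_apply, Pi.mul_apply, Pi.sub_apply]
    field_simp
    ring
  have h1 := diffNorm_add_le hρ h 1 (-((Z - 1) * fun s => (Z s)⁻¹))
  rw [← heq, diffNorm_neg] at h1
  have h2 := diffNorm_mul_le hρ h (Z - 1) fun s => (Z s)⁻¹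
  have h3 := mul_le_mul_of_nonneg_right hq (diffNorm_nonneg hρ h fun s => (Z s)⁻¹)
  rw [le_div_iff₀ (by linarith)]
  linarith [diffNorm_one_le ρ h]

end DiffNorm

/-! ### Covariances over pairs and summation by parts -/

section PairCov

variable {ι : Type*} [Fintype ι]

/-- The covariance of `f` and `g` under the weights `P`, as a sum over pairs. -/
noncomputable def pairCov (P f g : ι → ℝ) : ℝ :=
  (1 / 2) * ∑ i, ∑ j, P i * P j * ((f i - f j) * (g i - g j))

theorem pairCov_self_nonneg {P : ι → ℝ} (hP : ∀ i, 0 ≤ P i) (f : ι → ℝ) :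
    0 ≤ pairCov P f f :=
  mul_nonneg (by norm_num) <| sum_nonneg fun i _ => sum_nonneg fun j _ =>
    mul_nonneg (mul_nonneg (hP i) (hP j)) (mul_self_nonneg _)

theorem pairCov_eq {P : ι → ℝ} (hP : ∑ i, P i = 1) (f g : ι → ℝ) :
    pairCov P f g = ∑ i, P i * (f i * g i) - (∑ i, P i * f i) * ∑ i, P i * g i := by
  have h1 : ∀ i, ∑ j, P i * P j * ((f i - f j) * (g i - g j)) =
      P i * (f i * g i) - P i * f i * ∑ j, P j * g j - P i * g i * ∑ j, P j * f j
        + P i * ∑ j, P j * (f j * g j) := by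
    intro i
    calc ∑ j, P i * P j * ((f i - f j) * (g i - g j))
        = ∑ j, (P i * (f i * g i) * P j - P i * f i * (P j * g j) - P i * g i * (P j * f j)
          + P i * (P j * (f j * g j))) := sum_congr rfl fun j _ => by ring
      _ = _ := by
        rw [sum_add_distrib, sum_sub_distrib, sum_sub_distrib, ← mul_sum, ← mul_sum, ← mul_sum,
          ← mul_sum, hP, mul_one]
  unfold pairCov
  simp_rw [h1]
  rw [sum_add_distrib, sum_sub_distrib, sum_sub_distrib, ← sum_mul, ← sum_mul, ← sum_mul, hP]
  ring

theorem pairCov_le_sq {P : ι → ℝ} (hP : ∀ i, 0 ≤ P i) (hP1 : ∑ i, P i = 1) {f g : ι → ℝ}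
    {a b : ℝ} (hf : ∀ i, |f i| ≤ a) (hg : ∀ i, |g i| ≤ b) : |pairCov P f g| ≤ 2 * a * b := by
  have hterm : ∀ i j, |P i * P j * ((f i - f j) * (g i - g j))| ≤ P i * P j * (4 * a * b) := by
    intro i j
    have h1 : |f i - f j| ≤ 2 * a := by
      have := abs_sub (f i) (f j); linarith [hf i, hf j]
    have h2 : |g i - g j| ≤ 2 * b := by
      have := abs_sub (g i) (g j); linarith [hg i, hg j]
    rw [abs_mul, abs_of_nonneg (mul_nonneg (hP i) (hP j)), abs_mul]
    refine mul_le_mul_of_nonneg_left ?_ (mul_nonneg (hP i) (hP j))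
    calc |f i - f j| * |g i - g j| ≤ (2 * a) * (2 * b) :=
          mul_le_mul h1 h2 (abs_nonneg _) ((abs_nonneg _).trans h1)
      _ = 4 * a * b := by ring
  unfold pairCov
  rw [abs_mul, abs_of_nonneg (by norm_num : (0 : ℝ) ≤ 1 / 2)]
  have : |∑ i, ∑ j, P i * P j * ((f i - f j) * (g i - g j))| ≤
      ∑ i, ∑ j, P i * P j * (4 * a * b) :=
    (abs_sum_le_sum_abs _ _).trans (sum_le_sum fun i _ =>
      (abs_sum_le_sum_abs _ _).trans (sum_le_sum fun j _ => hterm i j))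
  have heq : ∑ i, ∑ j, P i * P j * (4 * a * b) = 4 * a * b := by
    simp_rw [← sum_mul, ← mul_sum, hP1, mul_one, hP1, one_mul]
  linarith

/-- Weighted AM–GM on each pair. The free parameter is later tuned separately for each order of
differences. -/
theorem two_mul_abs_pairCov_le {P : ι → ℝ} (hP : ∀ i, 0 ≤ P i) (f g : ι → ℝ) {s : ℝ}
    (hs : 0 < s) : 2 * |pairCov P f g| ≤ s * pairCov P f f + pairCov P g g / s := by
  have key : ∀ i j, |P i * P j * ((f i - f j) * (g i - g j))| ≤
      s / 2 * (P i * P j * ((f i - f j) * (f i - f j))) +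
      1 / (2 * s) * (P i * P j * ((g i - g j) * (g i - g j))) := by
    intro i j
    set a := f i - f j
    set b := g i - g j
    have hp := mul_nonneg (hP i) (hP j)
    rw [abs_mul, abs_of_nonneg hp, abs_mul]
    have h0 : |a| * |b| ≤ s / 2 * (a * a) + 1 / (2 * s) * (b * b) := by
      rw [← abs_mul_abs_self a, ← abs_mul_abs_self b]
      have : s / 2 * (|a| * |a|) + 1 / (2 * s) * (|b| * |b|) - |a| * |b| =
        (s * |a| - |b|) ^ 2 / (2 * s) := by field_simp; ring
      have h2 : 0 ≤ (s * |a| - |b|) ^ 2 / (2 * s) := by positivity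
      linarith
    calc P i * P j * (|a| * |b|) ≤ P i * P j * (s / 2 * (a * a) + 1 / (2 * s) * (b * b)) :=
          mul_le_mul_of_nonneg_left h0 hp
      _ = _ := by ring
  have hsum : |∑ i, ∑ j, P i * P j * ((f i - f j) * (g i - g j))| ≤
      s / 2 * (∑ i, ∑ j, P i * P j * ((f i - f j) * (f i - f j))) +
      1 / (2 * s) * (∑ i, ∑ j, P i * P j * ((g i - g j) * (g i - g j))) := by
    refine (abs_sum_le_sum_abs _ _).trans ?_
    simp_rw [mul_sum]
    rw [← sum_add_distrib]
    refine sum_le_sum fun i _ => (abs_sum_le_sum_abs _ _).trans ?_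
    rw [← sum_add_distrib]
    exact sum_le_sum fun j _ => key i j
  unfold pairCov
  rw [abs_mul, abs_of_nonneg (by norm_num : (0 : ℝ) ≤ 1 / 2)]
  calc _ = |∑ i, ∑ j, P i * P j * ((f i - f j) * (g i - g j))| := by ring
    _ ≤ _ := hsum
    _ = _ := by field_simp

/-- The sum over pairs contains no mean, which would move with the weights. A relative perturbation
of the pair weights thus acts on each nonnegative term separately. -/
theorem pairCov_self_le_of_close {P Q : ι → ℝ} {θ : ℝ}
    (hPQ : ∀ i j, |P i * P j - Q i * Q j| ≤ θ * (Q i * Q j)) (f : ι → ℝ) :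
    pairCov P f f ≤ (1 + θ) * pairCov Q f f := by
  unfold pairCov
  rw [mul_left_comm]
  refine mul_le_mul_of_nonneg_left ?_ (by norm_num : (0 : ℝ) ≤ 1 / 2)
  rw [mul_sum]
  refine sum_le_sum fun i _ => ?_
  rw [mul_sum]
  refine sum_le_sum fun j _ => ?_
  rw [← mul_assoc (1 + θ)]
  refine mul_le_mul_of_nonneg_right ?_ (mul_self_nonneg (f i - f j))
  have h := le_of_abs_le (hPQ i j)
  linarith

theorem two_mul_abs_pairCov_sub_le {P Q : ι → ℝ} {θ : ℝ} (hQ : ∀ i, 0 ≤ Q i)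
    (hPQ : ∀ i j, |P i * P j - Q i * Q j| ≤ θ * (Q i * Q j)) (f g : ι → ℝ) (hθ : 0 ≤ θ) :
    2 * |pairCov P f g - pairCov Q f g| ≤ θ * (pairCov Q f f + pairCov Q g g) := by
  have key : ∀ i j, |(P i * P j - Q i * Q j) * ((f i - f j) * (g i - g j))| ≤
      θ / 2 * (Q i * Q j * ((f i - f j) * (f i - f j)) +
        Q i * Q j * ((g i - g j) * (g i - g j))) := by
    intro i j
    set a := f i - f j
    set b := g i - g j
    have hp := mul_nonneg (hQ i) (hQ j)
    rw [abs_mul, abs_mul a b]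
    have h0 : |a| * |b| ≤ (a * a + b * b) / 2 := by
      rw [← abs_mul_abs_self a, ← abs_mul_abs_self b]
      nlinarith [sq_nonneg (|a| - |b|)]
    calc _ ≤ θ * (Q i * Q j) * ((a * a + b * b) / 2) :=
          mul_le_mul (hPQ i j) h0 (by positivity) (by positivity)
      _ = _ := by ring
  have hsum : |∑ i, ∑ j, (P i * P j - Q i * Q j) * ((f i - f j) * (g i - g j))| ≤
      θ / 2 * ((∑ i, ∑ j, Q i * Q j * ((f i - f j) * (f i - f j))) +
        ∑ i, ∑ j, Q i * Q j * ((g i - g j) * (g i - g j))) := by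
    refine (abs_sum_le_sum_abs _ _).trans ?_
    rw [← sum_add_distrib, mul_sum]
    refine sum_le_sum fun i _ => (abs_sum_le_sum_abs _ _).trans ?_
    rw [← sum_add_distrib, mul_sum]
    exact sum_le_sum fun j _ => key i j
  have heq : pairCov P f g - pairCov Q f g =
      (1 / 2) * ∑ i, ∑ j, (P i * P j - Q i * Q j) * ((f i - f j) * (g i - g j)) := by
    unfold pairCov
    simp_rw [sub_mul, sum_sub_distrib]
    ring
  rw [heq, abs_mul, abs_of_nonneg (by norm_num : (0 : ℝ) ≤ 1 / 2)]
  unfold pairCov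
  linarith

theorem pairCov_sub_right (P f g g' : ι → ℝ) :
    pairCov P f (g - g') = pairCov P f g - pairCov P f g' := by
  unfold pairCov
  rw [← mul_sub, ← sum_sub_distrib]
  congr 1
  refine sum_congr rfl fun i _ => ?_
  rw [← sum_sub_distrib]
  refine sum_congr rfl fun j _ => ?_
  simp only [Pi.sub_apply]; ring

theorem pairCov_comm (P f g : ι → ℝ) : pairCov P f g = pairCov P g f := by
  unfold pairCov
  congr 1
  exact sum_congr rfl fun i _ => sum_congr rfl fun j _ => by ring

/-- One step of summation by parts. -/
theorem pairCov_fwdDiff_step {P Q : ι → ℝ} {θ κ : ℝ} (hP : ∀ i, 0 ≤ P i) (hQ : ∀ i, 0 ≤ Q i)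
    (hθ : 0 ≤ θ) (hκ : 0 < κ)
    (hPQ : ∀ i j, |P i * P j - Q i * Q j| ≤ θ * (Q i * Q j)) (f f' d d' : ι → ℝ)
    (hd : f' - f = d) :
    pairCov P d d ≤ pairCov Q f' d' - pairCov P f d +
      θ / 2 * (pairCov Q f' f' + pairCov Q d' d') +
      κ / 2 * ((1 + θ) * pairCov Q f' f') + 1 / (2 * κ) * pairCov P (d' - d) (d' - d) := by
  have h1 := two_mul_abs_pairCov_sub_le hQ hPQ f' d' hθ
  have h2 := two_mul_abs_pairCov_le hP f' (d' - d) hκ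
  have h3 := mul_le_mul_of_nonneg_left (pairCov_self_le_of_close hPQ f') hκ.le
  -- The discrete product rule: Cov(f', d') − Cov(f, d) telescopes over rounds once the weights `P`
  -- in its first term are replaced by `Q`, and only Cov(f', d' − d) needs AM–GM.
  have h4 : pairCov P d d = pairCov P f' d' - pairCov P f' (d' - d) - pairCov P f d := by
    have : pairCov P d d = pairCov P f' d - pairCov P f d := by
      conv_lhs => rw [pairCov_comm]
      rw [pairCov_comm P f' d, pairCov_comm P f d, ← pairCov_sub_right, hd]
    rw [this, pairCov_sub_right]; ring
  have h5 : 1 / (2 * κ) * pairCov P (d' - d) (d' - d) =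
      pairCov P (d' - d) (d' - d) / κ / 2 := by field_simp
  have h6 := le_abs_self (pairCov P f' d' - pairCov Q f' d')
  have h7 := neg_abs_le (pairCov P f' (d' - d))
  rw [h4, h5]
  linarith

/-- Summation by parts for the energies of three consecutive differences of a sequence. -/
theorem sum_pairCov_fwdDiff_le {P : ℕ → ι → ℝ} {θ κ a b : ℝ} (S : ℕ)
    (hP : ∀ t < S, ∀ i, 0 ≤ P t i) (hP1 : ∀ t < S, ∑ i, P t i = 1)
    (hθ : 0 ≤ θ) (hκ : 0 < κ)
    (hPQ : ∀ t, t + 1 < S → ∀ i j,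
      |P t i * P t j - P (t + 1) i * P (t + 1) j| ≤ θ * (P (t + 1) i * P (t + 1) j))
    (f : ℕ → ι → ℝ) (ha : 0 ≤ a) (hb : 0 ≤ b) (hf : ∀ t < S, ∀ i, |f t i| ≤ a)
    (hd : ∀ t, t + 1 < S → ∀ i, |fwdDiff 1 f t i| ≤ b) :
    ∑ t ∈ range (S - 1), pairCov (P t) (fwdDiff 1 f t) (fwdDiff 1 f t) ≤
      4 * a * b + 2 * b * b
      + (κ / 2 * (1 + θ) + θ / 2) * ∑ t ∈ range S, pairCov (P t) (f t) (f t)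
      + θ / 2 * ∑ t ∈ range (S - 1), pairCov (P t) (fwdDiff 1 f t) (fwdDiff 1 f t)
      + 1 / (2 * κ) * ∑ t ∈ range (S - 2),
          pairCov (P t) (fwdDiff 1 (fwdDiff 1 f) t) (fwdDiff 1 (fwdDiff 1 f) t) := by
  have hf0 : ∀ t < S, 0 ≤ pairCov (P t) (f t) (f t) := fun t ht =>
    pairCov_self_nonneg (hP t ht) _
  have hA0 : 0 ≤ ∑ t ∈ range S, pairCov (P t) (f t) (f t) :=
    sum_nonneg fun t ht => hf0 t (mem_range.1 ht)
  rcases Nat.lt_or_ge S 2 with hS | hS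
  · have h1 : S - 1 = 0 := by omega
    have h2 : S - 2 = 0 := by omega
    rw [h1, h2]
    simp only [range_zero, sum_empty, mul_zero, add_zero]
    positivity
  obtain ⟨r, rfl⟩ := Nat.exists_eq_add_of_le' hS
  have e1 : r + 2 - 1 = r + 1 := by omega
  have e2 : r + 2 - 2 = r := by omega
  rw [e1, e2]
  set d := fwdDiff 1 f with hdd
  have hstep : ∀ t ∈ range r, pairCov (P t) (d t) (d t) ≤
      (pairCov (P (t + 1)) (f (t + 1)) (d (t + 1)) - pairCov (P t) (f t) (d t)) +
      ((κ / 2 * (1 + θ) + θ / 2) * pairCov (P (t + 1)) (f (t + 1)) (f (t + 1)) +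
      θ / 2 * pairCov (P (t + 1)) (d (t + 1)) (d (t + 1)) +
      1 / (2 * κ) * pairCov (P t) (fwdDiff 1 d t) (fwdDiff 1 d t)) := by
    intro t ht
    have ht := mem_range.1 ht
    have := pairCov_fwdDiff_step (hP t (by omega)) (hP (t + 1) (by omega)) hθ hκ
      (hPQ t (by omega)) (f t) (f (t + 1)) (d t) (d (t + 1)) rfl
    have e : fwdDiff 1 d t = d (t + 1) - d t := rfl
    rw [e]
    linarith
  have hsum := sum_le_sum hstep
  rw [sum_add_distrib, sum_range_sub (fun t => pairCov (P t) (f t) (d t)), sum_add_distrib,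
    sum_add_distrib, ← mul_sum, ← mul_sum, ← mul_sum] at hsum
  -- The two ends of the telescoping sum cost 2ab each. The last energy, to which no summation by
  -- parts is applied, costs 2b².
  have hb1 := pairCov_le_sq (hP r (by omega)) (hP1 r (by omega)) (hf r (by omega))
    (hd r (by omega))
  have hb2 := pairCov_le_sq (hP 0 (by omega)) (hP1 0 (by omega)) (hf 0 (by omega))
    (hd 0 (by omega))
  have hb3 := pairCov_le_sq (hP r (by omega)) (hP1 r (by omega)) (hd r (by omega))
    (hd r (by omega))
  have hA : ∑ t ∈ range r, pairCov (P (t + 1)) (f (t + 1)) (f (t + 1)) ≤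
      ∑ t ∈ range (r + 2), pairCov (P t) (f t) (f t) := by
    rw [sum_range_succ, sum_range_succ' _ r]
    linarith [hf0 0 (by omega), hf0 (r + 1) (by omega)]
  have hB : ∑ t ∈ range r, pairCov (P (t + 1)) (d (t + 1)) (d (t + 1)) ≤
      ∑ t ∈ range (r + 1), pairCov (P t) (d t) (d t) := by
    rw [sum_range_succ' _ r]
    linarith [pairCov_self_nonneg (hP 0 (by omega)) (d 0)]
  have hA' := mul_le_mul_of_nonneg_left hA (show 0 ≤ κ / 2 * (1 + θ) + θ / 2 by positivity)
  have hB' := mul_le_mul_of_nonneg_left hB (show 0 ≤ θ / 2 by positivity)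
  rw [sum_range_succ _ r] at hB' ⊢
  have := abs_le.1 hb1
  have := abs_le.1 hb2
  have := abs_le.1 hb3
  linarith

end PairCov

/-! ### Energies of successive differences -/

/-- A sequence of energies that is approximately log-convex, whose tail is small, has a small
first ratio. -/
theorem energy_ratio_le {A : ℕ → ℝ} {H : ℕ} {θ : ℝ} (hA : ∀ h, 0 ≤ A h) (hθ : 0 ≤ θ)
    (hH : 0 < H) (hθH : 35 * θ ≤ 1 / (H : ℝ))
    (hlast : A (H + 1) ≤ 8 * (1 / 32 : ℝ) ^ H)
    (hrec : ∀ h < H, ∀ κ : ℝ, 0 < κ → A (h + 1) ≤ 24 * (1 / 64 : ℝ) ^ h +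
      (κ / 2 * (1 + θ) + θ / 2) * A h + θ / 2 * A (h + 1) + 1 / (2 * κ) * A (h + 2)) :
    A 1 ≤ 3 / 32 * A 0 + 312 := by
  set τ : ℝ := 1 / (H : ℝ) with hτ
  have hH1 : (1 : ℝ) ≤ H := by exact_mod_cast hH
  have hτ0 : 0 < τ := by positivity
  have hτ1 : τ ≤ 1 := by rw [hτ, div_le_one (by linarith)]; exact hH1
  -- Descending induction on h. The drift of the weights costs a factor 1 + τ per order, at most e
  -- over all H orders. The error coefficients 96 and 8 reproduce themselves under the recursion, as
  -- `hB'` records.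
  have main : ∀ k h : ℕ, h + k = H → A (h + 1) ≤ (1 + τ) ^ k / 32 * A h +
      (1 + τ) ^ k * (96 * (1 / 64 : ℝ) ^ h + 8 * (1 / 32 : ℝ) ^ h) := by
    intro k
    induction k with
    | zero =>
      intro h hh
      obtain rfl : h = H := by omega
      have : (0 : ℝ) ≤ 96 * (1 / 64 : ℝ) ^ h := by positivity
      have := hA h
      simp only [pow_zero]
      linarith
    | succ k ih =>
      intro h hh
      have h1 := ih (h + 1) (by omega)
      set q := (1 + τ) ^ k with hq
      have hq1 : 1 ≤ q := one_le_pow₀ (by linarith)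
      -- With κ equal to the ratio known at the next order, the term A (h + 2)/(2κ) is at most A (h
      -- + 1)/2 plus an error. This is absorbed on the left, and the ratio κ survives.
      have h2 := hrec h (by omega) (q / 32) (by positivity)
      set B := 96 * (1 / 64 : ℝ) ^ (h + 1) + 8 * (1 / 32 : ℝ) ^ (h + 1) with hB
      have hB' : 48 * (1 / 64 : ℝ) ^ h + 32 * B = 96 * (1 / 64 : ℝ) ^ h + 8 * (1 / 32 : ℝ) ^ h := by
        rw [hB, pow_succ, pow_succ]; ring
      have h3 : 1 / (2 * (q / 32)) * A (h + 2) ≤ 1 / 2 * A (h + 1) + 16 * B := by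
        have : 1 / (2 * (q / 32)) * (q / 32 * A (h + 1) + q * B) = 1 / 2 * A (h + 1) + 16 * B := by
          field_simp; ring
        rw [← this]
        exact mul_le_mul_of_nonneg_left h1 (by positivity)
      have h4 : (1 - θ) * A (h + 1) ≤ 48 * (1 / 64 : ℝ) ^ h + 32 * B +
          (q / 32 * (1 + θ) + θ) * A h := by linarith
      rw [hB'] at h4
      set E := 96 * (1 / 64 : ℝ) ^ h + 8 * (1 / 32 : ℝ) ^ h with hE
      have hE0 : 0 ≤ E := by positivity
      have hA0 := hA h
      -- As q ≥ 1, the left side is at most q/32·(1 + 33θ). The hypothesis 35θ ≤ τ leaves exactly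
      -- this much room after 2θ is spent on the factor 1 − θ, using τ ≤ 1.
      have h5 : q / 32 * (1 + θ) + θ ≤ (1 - θ) * ((1 + τ) * (q / 32)) := by
        have : 1 + 33 * θ ≤ (1 - θ) * (1 + τ) := by nlinarith
        nlinarith
      have h6 : E ≤ (1 - θ) * ((1 + τ) * q * E) := by
        have h7 : 1 ≤ (1 - θ) * (1 + τ) := by nlinarith
        have h8 : 1 ≤ (1 - θ) * (1 + τ) * q := by nlinarith
        nlinarith
      have h9 : 0 < 1 - θ := by linarith
      have h10 : (1 - θ) * A (h + 1) ≤
          (1 - θ) * ((1 + τ) * (q / 32) * A h + (1 + τ) * q * E) := by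
        have := mul_le_mul_of_nonneg_right h5 hA0
        linarith
      have h11 := le_of_mul_le_mul_left h10 h9
      rw [pow_succ, ← hq]
      linarith
  have h0 := main H 0 (by omega)
  have he : (1 + τ) ^ H ≤ 3 := by
    have h1 : 1 + τ ≤ Real.exp τ := by linarith [Real.add_one_le_exp τ]
    have h2 : (1 + τ) ^ H ≤ Real.exp τ ^ H := pow_le_pow_left₀ (by linarith) h1 H
    rw [← Real.exp_nat_mul, hτ, mul_one_div_cancel (by linarith)] at h2
    linarith [Real.exp_one_lt_d9]
  have hA0 := mul_le_mul_of_nonneg_right he (hA 0)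
  simp only [pow_zero, zero_add] at h0
  linarith

/-- If all high-order differences of a sequence decay geometrically and the weights vary slowly,
then the total variance of the first differences is small compared to that of the sequence. -/
theorem sum_pairCov_fwdDiff_le_of_decay {ι : Type*} [Fintype ι] {P : ℕ → ι → ℝ} {θ : ℝ}
    {S H : ℕ} (hH : 0 < H) (hSH : S ≤ 2 ^ H) (hθ : 0 ≤ θ) (hθH : 35 * θ ≤ 1 / (H : ℝ))
    (hP : ∀ t < S, ∀ i, 0 ≤ P t i) (hP1 : ∀ t < S, ∑ i, P t i = 1)
    (hPQ : ∀ t, t + 1 < S → ∀ i j,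
      |P t i * P t j - P (t + 1) i * P (t + 1) j| ≤ θ * (P (t + 1) i * P (t + 1) j))
    (f : ℕ → ι → ℝ)
    (hf : ∀ h ≤ H + 1, ∀ t, t + h < S → ∀ i, |(fwdDiff 1)^[h] f t i| ≤ 2 * (1 / 8 : ℝ) ^ h) :
    ∑ t ∈ range (S - 1), pairCov (P t) (fwdDiff 1 f t) (fwdDiff 1 f t) ≤
      3 / 32 * ∑ t ∈ range S, pairCov (P t) (f t) (f t) + 312 := by
  set A : ℕ → ℝ := fun h =>
    ∑ t ∈ range (S - h), pairCov (P t) ((fwdDiff 1)^[h] f t) ((fwdDiff 1)^[h] f t) with hAdef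
  have := energy_ratio_le (A := A) (H := H) (θ := θ) (fun h => sum_nonneg fun t ht =>
    pairCov_self_nonneg (hP t (by have := mem_range.1 ht; omega)) _) hθ hH hθH ?_ ?_
  · simpa [hAdef] using this
  · have hterm : ∀ t ∈ range (S - (H + 1)),
        pairCov (P t) ((fwdDiff 1)^[H + 1] f t) ((fwdDiff 1)^[H + 1] f t) ≤
          8 * (1 / 64 : ℝ) ^ (H + 1) := by
      intro t ht
      have ht := mem_range.1 ht
      have h1 := pairCov_le_sq (hP t (by omega)) (hP1 t (by omega))
        (hf (H + 1) le_rfl t (by omega)) (hf (H + 1) le_rfl t (by omega))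
      refine (le_abs_self _).trans (h1.trans_eq ?_)
      rw [show (1 / 64 : ℝ) = 1 / 8 * (1 / 8) by norm_num, mul_pow]; ring
    -- There are at most 2^H summands, so the decay 64^(−H) of each still beats the count and leaves
    -- 32^(−H). This is why orders up to log T are needed.
    have h1 := sum_le_sum hterm
    rw [sum_const, card_range, nsmul_eq_mul] at h1
    refine h1.trans ?_
    have h2 : ((S - (H + 1) : ℕ) : ℝ) ≤ 2 ^ H := by
      exact_mod_cast (Nat.sub_le _ _).trans hSH
    calc ((S - (H + 1) : ℕ) : ℝ) * (8 * (1 / 64 : ℝ) ^ (H + 1))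
        ≤ 2 ^ H * (8 * (1 / 64 : ℝ) ^ (H + 1)) := by gcongr
      _ = 8 * (1 / 64) * (2 ^ H * (1 / 64 : ℝ) ^ H) := by ring
      _ = 8 * (1 / 64) * (1 / 32 : ℝ) ^ H := by rw [← mul_pow]; norm_num
      _ ≤ 8 * (1 / 32 : ℝ) ^ H := by
        have : (0 : ℝ) ≤ (1 / 32 : ℝ) ^ H := by positivity
        linarith
  · intro h hh κ hκ
    have := sum_pairCov_fwdDiff_le (P := P) (θ := θ) (κ := κ) (a := 2 * (1 / 8 : ℝ) ^ h)
      (b := 2 * (1 / 8 : ℝ) ^ (h + 1)) (S - h) (fun t ht => hP t (by omega))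
      (fun t ht => hP1 t (by omega)) hθ hκ (fun t ht => hPQ t (by omega)) ((fwdDiff 1)^[h] f)
      (by positivity) (by positivity) (fun t ht => hf h (by omega) t (by omega))
      (fun t ht i => by
        rw [← Function.iterate_succ_apply' (fwdDiff 1) h f]
        exact hf (h + 1) (by omega) t (by omega) i)
    simp only [hAdef, Function.iterate_succ_apply']
    rw [show S - (h + 1) = S - h - 1 by omega, show S - (h + 2) = S - h - 2 by omega]
    have e : 4 * (2 * (1 / 8 : ℝ) ^ h) * (2 * (1 / 8 : ℝ) ^ (h + 1)) +
        2 * (2 * (1 / 8 : ℝ) ^ (h + 1)) * (2 * (1 / 8 : ℝ) ^ (h + 1)) ≤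
        24 * (1 / 64 : ℝ) ^ h := by
      rw [show (1 / 64 : ℝ) = 1 / 8 * (1 / 8) by norm_num, mul_pow, pow_succ]
      have : (0 : ℝ) ≤ (1 / 8 : ℝ) ^ h * (1 / 8 : ℝ) ^ h := by positivity
      linarith
    linarith

/-! ### Second-order bounds for log moment generating functions -/

theorem exp_quadratic_bounds {u : ℝ} (hu : |u| ≤ 1 / 10) :
    1 + u + 9 / 20 * u ^ 2 ≤ Real.exp u ∧ Real.exp u ≤ 1 + u + 3 / 5 * u ^ 2 := by
  have h := Real.exp_bound (x := u) (by linarith) (n := 3) (by norm_num)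
  simp only [sum_range_succ, range_zero, sum_empty, Nat.factorial] at h
  norm_num at h
  have h3 : |u| ^ 3 ≤ 1 / 10 * u ^ 2 := by
    rw [pow_succ, sq_abs, mul_comm]
    exact mul_le_mul_of_nonneg_right hu (sq_nonneg u)
  have := abs_le.1 h
  constructor <;> nlinarith [sq_nonneg u]

/-- Two-sided second-order bounds for the logarithmic moment generating function. -/
theorem log_sum_exp_bounds {ι : Type*} [Fintype ι] {P X : ι → ℝ} {c : ℝ}
    (hP : ∀ i, 0 ≤ P i) (hP1 : ∑ i, P i = 1) (hX : ∀ i, |X i| ≤ 1) (hc : |c| ≤ 1 / 20) :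
    c * ∑ i, P i * X i + 2 / 5 * c ^ 2 * pairCov P X X ≤ Real.log (∑ i, P i * Real.exp (c * X i)) ∧
    Real.log (∑ i, P i * Real.exp (c * X i)) ≤
      c * ∑ i, P i * X i + 3 / 5 * c ^ 2 * pairCov P X X := by
  set μ := ∑ i, P i * X i with hμ
  have hμ1 : |μ| ≤ 1 := by
    calc |μ| ≤ ∑ i, |P i * X i| := abs_sum_le_sum_abs _ _
      _ ≤ ∑ i, P i := sum_le_sum fun i _ => by
          rw [abs_mul, abs_of_nonneg (hP i)]
          exact mul_le_of_le_one_right (hP i) (hX i)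
      _ = 1 := hP1
  have hu : ∀ i, |c * (X i - μ)| ≤ 1 / 10 := by
    intro i
    have h1 : |X i - μ| ≤ 2 := by have := abs_sub (X i) μ; linarith [hX i]
    rw [abs_mul]
    calc |c| * |X i - μ| ≤ 1 / 20 * 2 := mul_le_mul hc h1 (abs_nonneg _) (by norm_num)
      _ = 1 / 10 := by norm_num
  set V := pairCov P X X with hV
  have hV0 : 0 ≤ V := pairCov_self_nonneg hP X
  have hV2 : V ≤ 2 := by
    have := pairCov_le_sq hP hP1 hX hX
    linarith [le_abs_self (pairCov P X X)]
  have hquad : ∀ K : ℝ, ∑ i, P i * (1 + c * (X i - μ) + K * (c * (X i - μ)) ^ 2) =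
      1 + K * c ^ 2 * V := by
    intro K
    rw [hV, pairCov_eq hP1, ← hμ]
    calc ∑ i, P i * (1 + c * (X i - μ) + K * (c * (X i - μ)) ^ 2)
        = ∑ i, ((1 - c * μ + K * c ^ 2 * μ ^ 2) * P i + (c - 2 * K * c ^ 2 * μ) * (P i * X i) +
            K * c ^ 2 * (P i * (X i * X i))) := sum_congr rfl fun i _ => by ring
      _ = _ := by
        rw [sum_add_distrib, sum_add_distrib, ← mul_sum, ← mul_sum, ← mul_sum, hP1, ← hμ]
        ring
  -- Centring at the mean removes the linear term, so that the remaining factor is 1 plus a multiple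
  -- of the variance.
  have hfac : ∑ i, P i * Real.exp (c * X i) =
      Real.exp (c * μ) * ∑ i, P i * Real.exp (c * (X i - μ)) := by
    rw [mul_sum]
    refine sum_congr rfl fun i _ => ?_
    rw [mul_left_comm, ← Real.exp_add]; ring_nf
  set M := ∑ i, P i * Real.exp (c * (X i - μ)) with hM
  have hlow : 1 + 9 / 20 * c ^ 2 * V ≤ M := by
    rw [← hquad]
    exact sum_le_sum fun i _ => mul_le_mul_of_nonneg_left (exp_quadratic_bounds (hu i)).1 (hP i)
  have hup : M ≤ 1 + 3 / 5 * c ^ 2 * V := by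
    rw [← hquad]
    exact sum_le_sum fun i _ => mul_le_mul_of_nonneg_left (exp_quadratic_bounds (hu i)).2 (hP i)
  have hcV : 0 ≤ c ^ 2 * V := by positivity
  have hM0 : 0 < M := by linarith
  rw [hfac, Real.log_mul (Real.exp_pos _).ne' hM0.ne', Real.log_exp]
  have hc2 : c ^ 2 ≤ 1 / 400 := by
    rw [← sq_abs]; calc |c| ^ 2 ≤ (1 / 20) ^ 2 := pow_le_pow_left₀ (abs_nonneg _) hc 2
      _ = 1 / 400 := by norm_num
  constructor
  · have h1 : 1 - M⁻¹ ≤ Real.log M := Real.one_sub_inv_le_log_of_pos hM0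
    have h2 : M⁻¹ ≤ (1 + 9 / 20 * c ^ 2 * V)⁻¹ := inv_anti₀ (by linarith) hlow
    have h3 : (1 + 9 / 20 * c ^ 2 * V)⁻¹ ≤ 1 - 2 / 5 * c ^ 2 * V := by
      rw [inv_le_iff_one_le_mul₀ (by linarith)]
      have : c ^ 2 * V ≤ 1 / 200 := by nlinarith
      nlinarith
    linarith
  · have := Real.log_le_sub_one_of_pos hM0
    linarith

/-! ### Optimistic Hedge against a given sequence of losses -/

namespace OptHedge

namespace IsOptimisticHedge

variable {N T : ℕ} {η : ℝ} {l y : ℕ → Fin N → ℝ}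

theorem pos_and_sum_eq_one (h : IsOptimisticHedge η T l y) (hN : 1 ≤ N) {t : ℕ} (ht : 1 ≤ t)
    (htT : t ≤ T) : (∀ j, 0 < y t j) ∧ ∑ j, y t j = 1 := by
  have : Nonempty (Fin N) := ⟨⟨0, hN⟩⟩
  have hN' : (0 : ℝ) < N := by exact_mod_cast hN
  induction t, ht using Nat.le_induction with
  | base =>
    refine ⟨fun j => ?_, ?_⟩
    · rw [h.init]; positivity
    · simp only [h.init, sum_const, card_univ, Fintype.card_fin, nsmul_eq_mul]
      field_simp
  | succ t ht ih =>
    obtain ⟨ih1, -⟩ := ih (by omega)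
    have hpos : ∀ j, 0 < y t j * Real.exp (-η * (2 * l t j - l (t - 1) j)) := fun j =>
      mul_pos (ih1 j) (Real.exp_pos _)
    have hsum : 0 < ∑ k, y t k * Real.exp (-η * (2 * l t k - l (t - 1) k)) :=
      sum_pos (fun j _ => hpos j) univ_nonempty
    refine ⟨fun j => ?_, ?_⟩
    · rw [h.step t ht (by omega)]; exact div_pos (hpos j) hsum
    · simp only [h.step t ht (by omega)]
      rw [← sum_div, div_self hsum.ne']

/-- The strategies over a stretch of rounds in closed form. -/
theorem eq_exp_sum (h : IsOptimisticHedge η T l y) (hN : 1 ≤ N) {t₀ : ℕ} (ht : 1 ≤ t₀) :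
    ∀ s, t₀ + s ≤ T → ∀ j, y (t₀ + s) j =
      y t₀ j * Real.exp (∑ r ∈ range s, -η * (2 * l (t₀ + r) j - l (t₀ + r - 1) j)) /
        ∑ k, y t₀ k * Real.exp (∑ r ∈ range s, -η * (2 * l (t₀ + r) k - l (t₀ + r - 1) k)) := by
  have : Nonempty (Fin N) := ⟨⟨0, hN⟩⟩
  intro s
  induction s with
  | zero =>
    intro hs j
    simp [(h.pos_and_sum_eq_one hN ht hs).2]
  | succ s ih =>
    intro hs j
    have ih := ih (by omega)
    have hp := (h.pos_and_sum_eq_one hN ht (by omega)).1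
    have hZ : 0 < ∑ k, y t₀ k *
        Real.exp (∑ r ∈ range s, -η * (2 * l (t₀ + r) k - l (t₀ + r - 1) k)) :=
      sum_pos (fun j _ => mul_pos (hp j) (Real.exp_pos _)) univ_nonempty
    rw [← add_assoc, h.step (t₀ + s) (by omega) (by omega)]
    simp only [ih, sum_range_succ, Real.exp_add, div_mul_eq_mul_div]
    rw [← sum_div, div_div_div_cancel_right₀ hZ.ne']
    simp only [mul_assoc]

/-- The probabilities of pairs of actions change slowly from round to round. -/
theorem abs_pair_sub_le (h : IsOptimisticHedge η T l y) (hN : 1 ≤ N) (hη : 0 ≤ η)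
    (hη' : 12 * η ≤ 1) {t : ℕ} (ht : 1 ≤ t) (htT : t < T)
    (hg : ∀ j, |2 * l t j - l (t - 1) j| ≤ 3) (i j : Fin N) :
    |y t i * y t j - y (t + 1) i * y (t + 1) j| ≤
      24 * η * (y (t + 1) i * y (t + 1) j) := by
  have : Nonempty (Fin N) := ⟨⟨0, hN⟩⟩
  obtain ⟨hp, hs⟩ := h.pos_and_sum_eq_one hN ht htT.le
  obtain ⟨hp', -⟩ := h.pos_and_sum_eq_one hN (t := t + 1) (by omega) htT
  set e := fun k => Real.exp (-η * (2 * l t k - l (t - 1) k)) with he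
  have hup : ∀ k, e k ≤ Real.exp (3 * η) := fun k => Real.exp_le_exp.2 (by
    nlinarith [abs_le.1 (hg k)])
  have hlo : ∀ k, Real.exp (-(3 * η)) ≤ e k := fun k => Real.exp_le_exp.2 (by
    nlinarith [abs_le.1 (hg k)])
  set Z := ∑ k, y t k * e k with hZ
  have hZup : Z ≤ Real.exp (3 * η) := by
    calc Z ≤ ∑ k, y t k * Real.exp (3 * η) :=
          sum_le_sum fun k _ => mul_le_mul_of_nonneg_left (hup k) (hp k).le
      _ = _ := by rw [← sum_mul, hs, one_mul]
  have hZlo : Real.exp (-(3 * η)) ≤ Z := by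
    calc Real.exp (-(3 * η)) = ∑ k, y t k * Real.exp (-(3 * η)) := by rw [← sum_mul, hs, one_mul]
      _ ≤ Z := sum_le_sum fun k _ => mul_le_mul_of_nonneg_left (hlo k) (hp k).le
  have hZ0 : 0 < Z := (Real.exp_pos _).trans_le hZlo
  have hstep : ∀ k, y (t + 1) k = y t k * e k / Z := h.step t ht htT
  -- One factor exp (3η) comes from the weight and one from the normaliser. A pair of actions then
  -- changes by at most R² = exp (12η) ≤ 1 + 24η in either direction.
  set R := Real.exp (6 * η) with hR
  have hR1 : R = Real.exp (3 * η) * Real.exp (3 * η) := by rw [← Real.exp_add, hR]; ring_nf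
  have hinv : Real.exp (3 * η) * Real.exp (-(3 * η)) = 1 := by rw [← Real.exp_add]; simp
  have hA := Real.exp_pos (3 * η)
  have hB := Real.exp_pos (-(3 * η))
  have h1 : ∀ k, y t k ≤ R * y (t + 1) k := by
    intro k
    rw [hstep, mul_div_assoc', le_div_iff₀ hZ0, hR1]
    have h2 : Z ≤ Real.exp (3 * η) * Real.exp (3 * η) * e k := by
      calc Z ≤ Real.exp (3 * η) * Real.exp (3 * η) * Real.exp (-(3 * η)) := by
            rw [mul_assoc, hinv, mul_one]; exact hZup
        _ ≤ _ := by gcongr; exact hlo k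
    calc y t k * Z ≤ y t k * (Real.exp (3 * η) * Real.exp (3 * η) * e k) :=
          mul_le_mul_of_nonneg_left h2 (hp k).le
      _ = _ := by ring
  have h2 : ∀ k, y (t + 1) k ≤ R * y t k := by
    intro k
    rw [hstep, div_le_iff₀ hZ0, hR1]
    have h2 : e k ≤ Real.exp (3 * η) * Real.exp (3 * η) * Z := by
      calc e k ≤ Real.exp (3 * η) * Real.exp (3 * η) * Real.exp (-(3 * η)) := by
            rw [mul_assoc, hinv, mul_one]; exact hup k
        _ ≤ _ := by gcongr
    calc y t k * e k ≤ y t k * (Real.exp (3 * η) * Real.exp (3 * η) * Z) :=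
          mul_le_mul_of_nonneg_left h2 (hp k).le
      _ = _ := by ring
  have hRb : R * R ≤ 1 + 24 * η := by
    have h3 := Real.abs_exp_sub_one_le (x := 12 * η) (by rwa [abs_of_nonneg (by positivity)])
    rw [abs_of_nonneg (by positivity : 0 ≤ 12 * η)] at h3
    rw [hR, ← Real.exp_add, show 6 * η + 6 * η = 12 * η by ring]
    linarith [le_of_abs_le h3]
  have hR0 : 0 < R := Real.exp_pos _
  have h3 : y t i * y t j ≤ R * R * (y (t + 1) i * y (t + 1) j) := by
    calc y t i * y t j ≤ (R * y (t + 1) i) * (R * y (t + 1) j) :=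
          mul_le_mul (h1 i) (h1 j) (hp j).le (mul_pos hR0 (hp' i)).le
      _ = _ := by ring
  have h4 : y (t + 1) i * y (t + 1) j ≤ R * R * (y t i * y t j) := by
    calc y (t + 1) i * y (t + 1) j ≤ (R * y t i) * (R * y t j) :=
          mul_le_mul (h2 i) (h2 j) (hp' j).le (mul_pos hR0 (hp i)).le
      _ = _ := by ring
  have hq := mul_pos (hp' i) (hp' j)
  have hq' := mul_pos (hp i) (hp j)
  rw [abs_le]
  constructor
  · have h5 := mul_le_mul_of_nonneg_right hRb hq'.le
    nlinarith
  · have h5 := mul_le_mul_of_nonneg_right hRb hq.le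
    linarith

/-- The regret of Optimistic Hedge is controlled by the variances of its losses. -/
theorem regret_le (h : IsOptimisticHedge η T l y) (hN : 1 ≤ N) (hη : 0 < η) (hη' : η ≤ 1 / 20)
    (hl0 : l 0 = 0) (hl : ∀ t ≤ T, ∀ j, l t j ∈ Set.Icc (0 : ℝ) 1) (j : Fin N) :
    ∑ t ∈ Icc 1 T, ∑ k, y t k * l t k - ∑ t ∈ Icc 1 T, l t j ≤
      Real.log N / η + η * ∑ t ∈ Icc 1 T,
        (3 / 5 * pairCov (y t) (l t - l (t - 1)) (l t - l (t - 1)) -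
          2 / 5 * pairCov (y t) (l (t - 1)) (l (t - 1))) := by
  have : Nonempty (Fin N) := ⟨⟨0, hN⟩⟩
  -- The potential of ordinary Hedge. The optimistic strategy `y t` counts the loss of round t − 1
  -- once more, as a prediction of the loss of round t.
  set W : ℕ → ℝ := fun t => ∑ k, Real.exp (-η * ∑ s ∈ range t, l s k) with hW
  have hWpos : ∀ t, 0 < W t := fun t => sum_pos (fun k _ => Real.exp_pos _) univ_nonempty
  have hy : ∀ t, 1 ≤ t → t ≤ T → ∃ Z : ℝ, 0 < Z ∧
      ∀ k, y t k = Real.exp (-η * (∑ s ∈ range t, l s k + l (t - 1) k)) / Z := by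
    intro t ht htT
    induction t, ht using Nat.le_induction with
    | base =>
      refine ⟨N, by exact_mod_cast hN, fun k => ?_⟩
      simp [h.init, hl0]
    | succ t ht ih =>
      obtain ⟨Z, hZ, ih⟩ := ih (by omega)
      have key : ∀ k, y t k * Real.exp (-η * (2 * l t k - l (t - 1) k)) =
          Real.exp (-η * (∑ s ∈ range (t + 1), l s k + l t k)) / Z := by
        intro k
        rw [ih, div_mul_eq_mul_div, ← Real.exp_add, sum_range_succ]
        congr 2; ring
      refine ⟨∑ k, Real.exp (-η * (∑ s ∈ range (t + 1), l s k + l t k)),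
        sum_pos (fun k _ => Real.exp_pos _) univ_nonempty, fun k => ?_⟩
      rw [h.step t ht (by omega)]
      simp only [key]
      rw [← sum_div, div_div_div_cancel_right₀ hZ.ne', Nat.add_sub_cancel]
  have hstep : ∀ t ∈ Icc 1 T, Real.log (W (t + 1)) - Real.log (W t) ≤
      -η * ∑ k, y t k * l t k + η ^ 2 *
        (3 / 5 * pairCov (y t) (l t - l (t - 1)) (l t - l (t - 1)) -
          2 / 5 * pairCov (y t) (l (t - 1)) (l (t - 1))) := by
    intro t ht
    obtain ⟨ht1, htT⟩ := mem_Icc.1 ht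
    obtain ⟨Z, hZ, hyZ⟩ := hy t ht1 htT
    obtain ⟨hp, hs⟩ := h.pos_and_sum_eq_one hN ht1 htT
    -- Both potentials are moment generating functions under `y t` with the same normaliser:
    -- replacing the prediction by the true loss gives W (t + 1), and undoing the prediction gives W
    -- t. The ratio needs an upper bound for the first and a lower bound for the second, whence the
    -- opposite signs of the variances.
    have e1 : ∑ k, y t k * Real.exp (-η * (l t - l (t - 1)) k) = W (t + 1) / Z := by
      rw [hW, sum_div]
      refine sum_congr rfl fun k _ => ?_
      rw [hyZ, div_mul_eq_mul_div, ← Real.exp_add, sum_range_succ, Pi.sub_apply]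
      congr 2; ring
    have e2 : ∑ k, y t k * Real.exp (η * l (t - 1) k) = W t / Z := by
      rw [hW, sum_div]
      refine sum_congr rfl fun k _ => ?_
      rw [hyZ, div_mul_eq_mul_div, ← Real.exp_add]
      congr 2; ring
    have hb1 := (log_sum_exp_bounds (P := y t) (X := l t - l (t - 1)) (c := -η)
      (fun k => (hp k).le) hs (fun k => by
        have h1 := hl t htT k
        have h2 := hl (t - 1) (by omega) k
        rw [Pi.sub_apply, abs_le]
        constructor <;> linarith [h1.1, h1.2, h2.1, h2.2])
      (by rw [abs_neg, abs_of_pos hη]; exact hη')).2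
    have hb2 := (log_sum_exp_bounds (P := y t) (X := l (t - 1)) (c := η)
      (fun k => (hp k).le) hs (fun k => by
        have h2 := hl (t - 1) (by omega) k
        rw [abs_of_nonneg h2.1]; exact h2.2)
      (by rw [abs_of_pos hη]; exact hη')).1
    rw [e1, Real.log_div (hWpos _).ne' hZ.ne'] at hb1
    rw [e2, Real.log_div (hWpos _).ne' hZ.ne'] at hb2
    simp only [Pi.sub_apply, mul_sub, sum_sub_distrib] at hb1
    linarith
  have hsum := sum_le_sum hstep
  have htel : ∑ t ∈ Icc 1 T, (Real.log (W (t + 1)) - Real.log (W t)) =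
      Real.log (W (T + 1)) - Real.log (W 1) := by
    rw [← Ico_add_one_right_eq_Icc, sum_Ico_sub (fun t => Real.log (W t)) (by omega)]
  have hW1 : W 1 = N := by simp [hW, hl0]
  have hWT : -η * ∑ t ∈ Icc 1 T, l t j ≤ Real.log (W (T + 1)) := by
    rw [Real.le_log_iff_exp_le (hWpos _)]
    have e : ∑ s ∈ range (T + 1), l s j = ∑ t ∈ Icc 1 T, l t j := by
      rw [range_eq_Ico, sum_eq_sum_Ico_succ_bot (by omega), hl0, Pi.zero_apply, zero_add,
        zero_add, Ico_add_one_right_eq_Icc]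
    rw [← e]
    exact single_le_sum (f := fun k => Real.exp (-η * ∑ s ∈ range (T + 1), l s k))
      (fun k _ => (Real.exp_pos _).le) (mem_univ j)
  rw [htel, hW1, sum_add_distrib, ← mul_sum, ← mul_sum] at hsum
  set D := ∑ t ∈ Icc 1 T, (3 / 5 * pairCov (y t) (l t - l (t - 1)) (l t - l (t - 1)) -
          2 / 5 * pairCov (y t) (l (t - 1)) (l (t - 1)))
  refine le_of_mul_le_mul_left ?_ hη
  have e : η * (Real.log N / η + η * D) = Real.log N + η ^ 2 * D := by field_simp
  rw [e]
  linarith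

end IsOptimisticHedge

end OptHedge

/-! ### High-order smoothness of strategies and losses in a game -/

/-- Since the `p k` sum to 1, the denominator differs from 1 by at most e^ν − 1 in norm and can be
inverted; e^ν (1 − ν) ≤ 1 simplifies the resulting e^ν/(2 − e^ν). Keeping the factor `p j` makes
later sums over actions independent of their number. -/
theorem diffNorm_softmax_le {ι : Type*} [Fintype ι] {ρ ν : ℝ} (hρ : 0 ≤ ρ) (h : ℕ)
    {p : ι → ℝ} (hp : ∀ k, 0 < p k) (hp1 : ∑ k, p k = 1) {u : ι → ℕ → ℝ}
    (hν : ν ≤ 1 / 4) (hu : ∀ k, diffNorm ρ h (u k) ≤ ν) (j : ι) :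
    diffNorm ρ h (fun s => p j * Real.exp (u j s) / ∑ k, p k * Real.exp (u k s)) ≤
      p j * (1 / (1 - 2 * ν)) := by
  set Z : ℕ → ℝ := fun s => ∑ k, p k * Real.exp (u k s) with hZ
  have hZ0 : ∀ s, Z s ≠ 0 := fun s =>
    (sum_pos (fun k _ => mul_pos (hp k) (Real.exp_pos _)) ⟨j, mem_univ j⟩).ne'
  have hZ1 : diffNorm ρ h (Z - 1) ≤ Real.exp ν - 1 := by
    have e : Z - 1 = ∑ k, p k • fun s => Real.exp (u k s) - 1 := by
      ext s
      simp [hZ, Finset.sum_apply, mul_sub, sum_sub_distrib, hp1]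
    rw [e]
    refine (diffNorm_sum_le hρ h _ _).trans ?_
    calc ∑ k, diffNorm ρ h (p k • fun s => Real.exp (u k s) - 1)
        ≤ ∑ k, p k * (Real.exp ν - 1) := sum_le_sum fun k _ => by
          rw [diffNorm_smul, abs_of_pos (hp k)]
          refine mul_le_mul_of_nonneg_left ((diffNorm_exp_sub_one_le hρ h _).trans ?_) (hp k).le
          linarith [Real.exp_le_exp.2 (hu k)]
      _ = _ := by rw [← sum_mul, hp1, one_mul]
  have hE : Real.exp ν * (1 - ν) ≤ 1 := by
    calc Real.exp ν * (1 - ν) ≤ Real.exp ν * Real.exp (-ν) :=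
          mul_le_mul_of_nonneg_left (by linarith [Real.add_one_le_exp (-ν)]) (Real.exp_pos _).le
      _ = 1 := by rw [← Real.exp_add]; simp
  have hE0 := Real.exp_pos ν
  have hE2 : Real.exp ν < 2 := by nlinarith
  have hY := diffNorm_inv_le hρ h hZ0 hZ1 (by linarith)
  have e : (fun s => p j * Real.exp (u j s) / Z s) =
      p j • ((fun s => Real.exp (u j s)) * fun s => (Z s)⁻¹) := by
    ext s; simp [div_eq_mul_inv, mul_assoc]
  rw [e, diffNorm_smul, abs_of_pos (hp j)]
  refine mul_le_mul_of_nonneg_left ?_ (hp j).le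
  calc _ ≤ diffNorm ρ h (fun s => Real.exp (u j s)) * diffNorm ρ h (fun s => (Z s)⁻¹) :=
        diffNorm_mul_le hρ h _ _
    _ ≤ Real.exp ν * (1 / (1 - (Real.exp ν - 1))) :=
        mul_le_mul ((diffNorm_exp_le hρ h _).trans (Real.exp_le_exp.2 (hu j))) hY
          (diffNorm_nonneg hρ h _) hE0.le
    _ ≤ 1 / (1 - 2 * ν) := by
        rw [mul_one_div, div_le_div_iff₀ (by linarith) (by linarith)]
        linarith

namespace OptHedge

variable {m : ℕ} {n : Fin m → ℕ}

theorem sum_filter_prod_erase (y : ∀ k, Fin (n k) → ℝ) (i : Fin m) (j : Fin (n i)) :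
    ∑ a : (∀ k, Fin (n k)) with a i = j, ∏ k ∈ univ.erase i, y k (a k) =
      ∏ k ∈ univ.erase i, ∑ c, y k c := by
  -- The constraint `a i = j` becomes a point mass for player `i`, and the sum of products over all
  -- profiles factorises.
  set z : ∀ k, Fin (n k) → ℝ := Function.update y i (Pi.single j 1) with hz
  have hzi : z i = Pi.single j 1 := Function.update_self ..
  have hzk : ∀ k ∈ univ.erase i, z k = y k := fun k hk =>
    Function.update_of_ne (ne_of_mem_erase hk) ..
  calc _ = ∑ a : (∀ k, Fin (n k)), ∏ k, z k (a k) := by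
        rw [sum_filter]
        refine sum_congr rfl fun a _ => ?_
        have hprod : ∏ k ∈ univ.erase i, z k (a k) = ∏ k ∈ univ.erase i, y k (a k) :=
          prod_congr rfl fun k hk => by rw [hzk k hk]
        rw [← mul_prod_erase univ _ (mem_univ i), hzi, hprod, Pi.single_apply]
        split_ifs <;> simp
    _ = ∏ k, ∑ c, z k c := by
        rw [prod_univ_sum, Fintype.piFinset_univ]
    _ = _ := by
        have hprod : ∏ k ∈ univ.erase i, ∑ c, z k c = ∏ k ∈ univ.erase i, ∑ c, y k c :=
          prod_congr rfl fun k hk => by rw [hzk k hk]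
        rw [← mul_prod_erase univ _ (mem_univ i), hzi, hprod]
        simp

theorem sum_filter_update (i : Fin m) (j c : Fin (n i)) (g : (∀ k, Fin (n k)) → ℝ) :
    ∑ a with a i = c, g (Function.update a i j) = ∑ a with a i = j, g a := by
  refine sum_nbij' (fun a => Function.update a i j) (fun a => Function.update a i c) ?_ ?_ ?_ ?_ ?_
  · intro a _; simp
  · intro a _; simp
  · intro a ha
    simp only [mem_filter, mem_univ, true_and] at ha
    simp [← ha]
  · intro a ha
    simp only [mem_filter, mem_univ, true_and] at ha
    simp [← ha]
  · intro a _; rfl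

namespace Game

variable (G : Game m n)

theorem expectedLoss_mem {x : ∀ k, Fin (n k) → ℝ} (hx : ∀ k c, 0 ≤ x k c)
    (hx1 : ∀ k, ∑ c, x k c = 1) (i : Fin m) (j : Fin (n i)) :
    G.expectedLoss x i j ∈ Set.Icc (0 : ℝ) 1 := by
  have h0 : ∀ a : ∀ k, Fin (n k), 0 ≤ ∏ k ∈ univ.erase i, x k (a k) := fun a =>
    prod_nonneg fun k _ => hx k _
  refine ⟨sum_nonneg fun a _ => mul_nonneg (h0 a) (G.loss_mem i a).1, ?_⟩
  calc G.expectedLoss x i j ≤ ∑ a : (∀ k, Fin (n k)) with a i = j, ∏ k ∈ univ.erase i, x k (a k) :=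
        sum_le_sum fun a _ => mul_le_of_le_one_right (h0 a) (G.loss_mem i a).2
    _ = 1 := by rw [sum_filter_prod_erase]; simp [hx1]

theorem sum_prod_mul_loss (x : ∀ k, Fin (n k) → ℝ) (i : Fin m) :
    ∑ a : (∀ k, Fin (n k)), (∏ k, x k (a k)) * G.loss i a = ∑ j, x i j * G.expectedLoss x i j := by
  rw [← sum_fiberwise univ (fun a : (∀ k, Fin (n k)) => a i)]
  refine sum_congr rfl fun j _ => ?_
  rw [expectedLoss, mul_sum]
  refine sum_congr rfl fun a ha => ?_
  rw [← mul_prod_erase univ _ (mem_univ i), (mem_filter.1 ha).2, mul_assoc]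

theorem sum_prod_mul_loss_update {x : ∀ k, Fin (n k) → ℝ} (i : Fin m) (hx1 : ∑ c, x i c = 1)
    (j : Fin (n i)) :
    ∑ a : (∀ k, Fin (n k)), (∏ k, x k (a k)) * G.loss i (Function.update a i j) =
      G.expectedLoss x i j := by
  rw [← sum_fiberwise univ (fun a : (∀ k, Fin (n k)) => a i)]
  have : ∀ c, ∑ a : (∀ k, Fin (n k)) with a i = c,
      (∏ k, x k (a k)) * G.loss i (Function.update a i j) = x i c * G.expectedLoss x i j := by
    intro c
    rw [expectedLoss, ← sum_filter_update i j c, mul_sum]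
    refine sum_congr rfl fun a ha => ?_
    rw [← mul_prod_erase univ _ (mem_univ i), (mem_filter.1 ha).2, mul_assoc]
    congr 2
    exact prod_congr rfl fun k hk => by rw [Function.update_of_ne (ne_of_mem_erase hk)]
  simp_rw [this]
  rw [← sum_mul, hx1, one_mul]

/-- The expected loss is multilinear in the strategies of the other m − 1 players. Their weights `p`
sum to 1 and the losses lie in [0, 1], so the sum over profiles costs nothing and each opponent
contributes one factor `r`. -/
theorem diffNorm_expectedLoss_le {ρ r : ℝ} (hρ : 0 ≤ ρ) (h : ℕ)
    (X : ℕ → ∀ k, Fin (n k) → ℝ) {p : ∀ k, Fin (n k) → ℝ} (hp1 : ∀ k, ∑ c, p k c = 1)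
    (hX : ∀ k c, diffNorm ρ h (fun s => X s k c) ≤ p k c * r) (i : Fin m) (j : Fin (n i)) :
    diffNorm ρ h (fun s => G.expectedLoss (X s) i j) ≤ r ^ (m - 1) := by
  have e : (fun s => G.expectedLoss (X s) i j) =
      ∑ a : (∀ k, Fin (n k)) with a i = j,
        G.loss i a • ∏ k ∈ univ.erase i, fun s => X s k (a k) := by
    ext s
    simp only [expectedLoss, Finset.sum_apply, Pi.smul_apply, Finset.prod_apply, smul_eq_mul]
    exact sum_congr rfl fun a _ => mul_comm _ _
  rw [e]
  calc _ ≤ ∑ a : (∀ k, Fin (n k)) with a i = j, ∏ k ∈ univ.erase i, p k (a k) * r := by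
        refine (diffNorm_sum_le hρ h _ _).trans (sum_le_sum fun a _ => ?_)
        rw [diffNorm_smul, abs_of_nonneg (G.loss_mem i a).1]
        refine (mul_le_of_le_one_left (diffNorm_nonneg hρ h _) (G.loss_mem i a).2).trans ?_
        exact (diffNorm_prod_le hρ h _ _).trans
          (prod_le_prod (fun k _ => diffNorm_nonneg hρ h _) fun k _ => hX k _)
    _ = r ^ (m - 1) := by
        rw [sum_filter_prod_erase (fun k c => p k c * r)]
        simp_rw [← sum_mul, hp1, one_mul]
        rw [prod_const, card_erase_of_mem (mem_univ i), card_univ, Fintype.card_fin]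

end Game

namespace Game.AllPlayOptimisticHedge

variable {G : Game m n} {η : ℝ} {T : ℕ} {x : ℕ → ∀ k, Fin (n k) → ℝ}

theorem lossVector_mem (hx : G.AllPlayOptimisticHedge η T x) (hn : ∀ i, 1 ≤ n i) (i : Fin m)
    {t : ℕ} (ht : t ≤ T) (j : Fin (n i)) : G.lossVector x i t j ∈ Set.Icc (0 : ℝ) 1 := by
  rw [Game.lossVector]
  split_ifs with h0
  · simp
  · have h := fun k => (hx k).pos_and_sum_eq_one (hn k) (Nat.one_le_iff_ne_zero.2 h0) ht
    exact G.expectedLoss_mem (fun k c => ((h k).1 c).le) (fun k => (h k).2) i j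

theorem abs_two_mul_sub_le (hx : G.AllPlayOptimisticHedge η T x) (hn : ∀ i, 1 ≤ n i) (i : Fin m)
    {t : ℕ} (ht : t ≤ T) (j : Fin (n i)) :
    |2 * G.lossVector x i t j - G.lossVector x i (t - 1) j| ≤ 3 := by
  have h1 := hx.lossVector_mem hn i ht j
  have h2 := hx.lossVector_mem hn i (t := t - 1) (by omega) j
  rw [abs_le]
  constructor <;> linarith [h1.1, h1.2, h2.1, h2.2]

/-- High-order smoothness: the iterated differences of the losses decay geometrically. -/
theorem abs_fwdDiff_iter_lossVector_le (hx : G.AllPlayOptimisticHedge η T x)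
    (hn : ∀ i, 1 ≤ n i) (hη : 0 ≤ η) {ρ : ℝ} (hρ : 0 < ρ) {H : ℕ}
    (hν : η * H * (3 + 6 * ρ) * (4 * m) ≤ 1) (h : ℕ) (hh : h ≤ H) :
    ∀ t, h + 1 ≤ t → t + h ≤ T → ∀ i (j : Fin (n i)),
      |(fwdDiff 1)^[h] (fun s => G.lossVector x i s j) t| ≤ 2 * (h.factorial / ρ ^ h) := by
  induction h using Nat.strong_induction_on with
  | _ h ih =>
  intro t ht htT i j
  set ν : ℝ := η * H * (3 + 6 * ρ) with hνdef
  have hm : (1 : ℝ) ≤ m := by exact_mod_cast i.pos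
  have hν0 : 0 ≤ ν := by positivity
  have hν4 : ν ≤ 1 / 4 := by nlinarith
  have hhH : (h : ℝ) ≤ H := by exact_mod_cast hh
  set u : ∀ k, Fin (n k) → ℕ → ℝ := fun k c s => ∑ r ∈ range s,
    -η * (2 * G.lossVector x k (t + r) c - G.lossVector x k (t + r - 1) c) with hu
  have hdu : ∀ k c, fwdDiff 1 (u k c) =
      (-(2 * η)) • (fun r => G.lossVector x k (r + t) c) +
        η • fun r => G.lossVector x k (r + (t - 1)) c := by
    intro k c
    ext r
    simp only [fwdDiff, hu, sum_range_succ, Pi.add_apply, Pi.smul_apply, smul_eq_mul]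
    rw [show t + r - 1 = r + (t - 1) by omega, add_comm t r]
    ring
  have huν : ∀ k c, diffNorm ρ h (u k c) ≤ ν := by
    intro k c
    unfold diffNorm
    rw [sum_range_succ']
    -- Order zero is the only one where the accumulated exponent itself enters. Higher differences
    -- of `u` are differences of the losses of one order less, covered by the induction hypothesis.
    have h0 : diffSup h 0 (u k c) ≤ 3 * η * h := by
      refine diffSup_le (Nat.zero_le _) fun s hs => ?_
      have hs' : (s : ℝ) ≤ h := by exact_mod_cast hs
      calc |(fwdDiff 1)^[0] (u k c) s| ≤ ∑ r ∈ range s, 3 * η := by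
            refine (abs_sum_le_sum_abs _ _).trans (sum_le_sum fun r hr => ?_)
            have hr := mem_range.1 hr
            rw [abs_mul, abs_neg, abs_of_nonneg hη, mul_comm]
            exact mul_le_mul_of_nonneg_right
              (hx.abs_two_mul_sub_le hn k (by omega) c) hη
        _ = 3 * η * s := by rw [sum_const, card_range, nsmul_eq_mul]; ring
        _ ≤ 3 * η * h := by gcongr
    have hk : ∀ k' ∈ range h, ρ ^ (k' + 1) / ((k' + 1).factorial : ℝ) *
        diffSup h (k' + 1) (u k c) ≤ 6 * η * ρ := by
      intro k' hk'
      have hk' := mem_range.1 hk'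
      have h1 : diffSup h (k' + 1) (u k c) ≤ 6 * η * (k'.factorial / ρ ^ k') := by
        refine diffSup_le (by omega) fun s hs => ?_
        rw [Function.iterate_succ_apply, hdu, fwdDiff_iter_add, fwdDiff_iter_const_smul,
          fwdDiff_iter_const_smul, Pi.add_apply, Pi.smul_apply, Pi.smul_apply,
          fwdDiff_iter_comp_add 1 (fun r => G.lossVector x k r c) t k' s,
          fwdDiff_iter_comp_add 1 (fun r => G.lossVector x k r c) (t - 1) k' s]
        have a1 := ih k' hk' (by omega) (s + t) (by omega) (by omega) k c
        -- The prediction looks one round back, so each order uses up one initial round. Hence the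
        -- condition h + 1 ≤ t, which also keeps the conventional zero loss of round 0 out of the
        -- differences.
        have a2 := ih k' hk' (by omega) (s + (t - 1)) (by omega) (by omega) k c
        refine (abs_add_le _ _).trans ?_
        rw [smul_eq_mul, smul_eq_mul, abs_mul, abs_mul, abs_neg, abs_of_nonneg hη,
          abs_of_nonneg (by positivity : 0 ≤ 2 * η)]
        have b1 := mul_le_mul_of_nonneg_left a1 (by positivity : 0 ≤ 2 * η)
        have b2 := mul_le_mul_of_nonneg_left a2 hη
        linarith
      calc _ ≤ ρ ^ (k' + 1) / ((k' + 1).factorial : ℝ) * (6 * η * (k'.factorial / ρ ^ k')) :=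
            mul_le_mul_of_nonneg_left h1 (by positivity)
        _ = 6 * η * ρ * (1 / ((k' : ℝ) + 1)) := by
            have : (k'.factorial : ℝ) ≠ 0 := by positivity
            rw [Nat.factorial_succ, pow_succ]; push_cast; field_simp
        _ ≤ 6 * η * ρ * 1 := by
            refine mul_le_mul_of_nonneg_left ?_ (by positivity)
            rw [div_le_one (by positivity)]
            linarith [(Nat.cast_nonneg k' : (0 : ℝ) ≤ k')]
        _ = _ := mul_one _
    have hs := sum_le_sum hk
    rw [sum_const, card_range, nsmul_eq_mul] at hs
    simp only [pow_zero, Nat.factorial_zero, Nat.cast_one, div_one, one_mul]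
    calc _ ≤ h * (6 * η * ρ) + 3 * η * h := add_le_add hs h0
      _ = η * h * (3 + 6 * ρ) := by ring
      _ ≤ ν := by rw [hνdef]; gcongr
  have hp := fun k => (hx k).pos_and_sum_eq_one (hn k) (t := t) (by omega) (by omega)
  have hX : ∀ k c, diffNorm ρ h (fun s => x (s + t) k c) ≤ x t k c * (1 / (1 - 2 * ν)) := by
    intro k c
    -- The closed form holds only up to round T, which suffices because the norm sees only the
    -- window 0, …, h.
    rw [diffNorm_congr (g := fun s => x t k c * Real.exp (u k c s) /
      ∑ c', x t k c' * Real.exp (u k c' s))]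
    · exact diffNorm_softmax_le hρ.le h (hp k).1 (hp k).2 hν4 (huν k) c
    · intro s hs
      rw [add_comm s t]
      exact (hx k).eq_exp_sum (hn k) (by omega) s (by omega) c
  have hN := G.diffNorm_expectedLoss_le hρ.le h (fun s => x (s + t)) (fun k => (hp k).2) hX i j
  have hR : (1 / (1 - 2 * ν)) ^ (m - 1) ≤ 2 := by
    -- Bernoulli's inequality with 4mν ≤ 1: this is where the step size must be small in proportion
    -- to 1/m.
    have hb := one_add_mul_le_pow (a := -(2 * ν)) (by linarith) (m - 1)
    have hm1 : ((m - 1 : ℕ) : ℝ) ≤ m := by exact_mod_cast Nat.sub_le _ _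
    have hb2 : 1 / 2 ≤ (1 - 2 * ν) ^ (m - 1) := by
      rw [← sub_eq_add_neg] at hb
      refine le_trans ?_ hb
      nlinarith
    rw [one_div, inv_pow]
    calc _ ≤ (1 / 2 : ℝ)⁻¹ := inv_anti₀ (by norm_num) hb2
      _ = 2 := by norm_num
  have hD : ρ ^ h / (h.factorial : ℝ) * |(fwdDiff 1)^[h] (fun s => G.lossVector x i s j) t| ≤ 2 := by
    refine le_trans ?_ (hN.trans hR)
    have e : (fwdDiff 1)^[h] (fun s => G.lossVector x i s j) t =
        (fwdDiff 1)^[h] (fun s => G.expectedLoss (x (s + t)) i j) 0 := by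
      have h0 := fwdDiff_iter_comp_add 1 (fun s => G.lossVector x i s j) t h 0
      rw [zero_add] at h0
      rw [← h0]
      refine congrArg (fun F => (fwdDiff 1)^[h] F 0) (funext fun s => ?_)
      rw [Game.lossVector, if_neg (by omega)]
    rw [e]
    calc _ ≤ ρ ^ h / (h.factorial : ℝ) *
          diffSup h h (fun s => G.expectedLoss (x (s + t)) i j) :=
          mul_le_mul_of_nonneg_left (abs_le_diffSup _ (by omega)) (by positivity)
      _ ≤ _ := single_le_sum (f := fun k => ρ ^ k / (k.factorial : ℝ) *
          diffSup h k (fun s => G.expectedLoss (x (s + t)) i j))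
          (fun k _ => mul_nonneg (by positivity) (diffSup_nonneg _ _ _)) (mem_range.2 (by omega))
  have hf : (0 : ℝ) < h.factorial := by positivity
  rw [div_mul_eq_mul_div, div_le_iff₀ hf] at hD
  rw [mul_div_assoc', le_div_iff₀ (by positivity)]
  linarith

end Game.AllPlayOptimisticHedge

end OptHedge

/-! ### From smoothness to regret and equilibrium -/

theorem fwdDiff_iter_apply {ι : Type*} (f : ℕ → ι → ℝ) (i : ι) (h : ℕ) : ∀ t,
    (fwdDiff 1)^[h] f t i = (fwdDiff 1)^[h] (fun s => f s i) t := by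
  induction h with
  | zero => intro t; rfl
  | succ h ih =>
    intro t
    simp only [Function.iterate_succ_apply', fwdDiff, Pi.sub_apply, ih]

theorem clog_two_le_two_mul_logb {T : ℕ} (hT : 2 ≤ T) :
    (Nat.clog 2 T : ℝ) ≤ 2 * Real.logb 2 T := by
  have hL : 1 ≤ Real.logb 2 T := by
    rw [Real.le_logb_iff_rpow_le (by norm_num) (by positivity), Real.rpow_one]
    exact_mod_cast hT
  have hlt : 2 ^ (Nat.clog 2 T - 1) < T := Nat.pow_pred_clog_lt_self (by norm_num) (by omega)
  have h1 : ((Nat.clog 2 T - 1 : ℕ) : ℝ) ≤ Real.logb 2 T := by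
    rw [Real.le_logb_iff_rpow_le (by norm_num) (by positivity), Real.rpow_natCast]
    exact_mod_cast hlt.le
  have hpos : 0 < Nat.clog 2 T := Nat.clog_pos (by norm_num) hT
  rw [Nat.cast_sub (by omega)] at h1
  push_cast at h1
  linarith

/-- Discards the first `s` rounds, where high-order smoothness is not available, and the last round;
each costs at most 2. -/
theorem sum_Icc_one_le_add_sum_range {D : ℕ → ℝ} {T : ℕ} (hD : ∀ t, 1 ≤ t → t ≤ T → D t ≤ 2)
    (s : ℕ) : ∑ t ∈ Icc 1 T, D t ≤
      2 * (s + 1) + ∑ t ∈ range (T - s - 1), D (s + t + 1) := by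
  have e : ∑ t ∈ Icc 1 T, D t = ∑ t ∈ range T, D (t + 1) := by
    rw [← Ico_add_one_right_eq_Icc, sum_Ico_eq_sum_range, Nat.add_sub_cancel]
    exact sum_congr rfl fun t _ => by rw [add_comm]
  have hb : ∀ K ≤ T, ∑ t ∈ range K, D (t + 1) ≤ 2 * K := fun K hK => by
    calc _ ≤ ∑ t ∈ range K, (2 : ℝ) :=
          sum_le_sum fun t ht => hD _ (by omega) (by have := mem_range.1 ht; omega)
      _ = 2 * K := by rw [sum_const, card_range, nsmul_eq_mul, mul_comm]
  rw [e]
  rcases Nat.lt_or_ge s T with hs | hs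
  · obtain ⟨r, rfl⟩ := Nat.exists_eq_add_of_lt hs
    rw [show s + r + 1 - s - 1 = r by omega, sum_range_succ, sum_range_add]
    have := hb s (by omega)
    have := hD (s + r + 1) (by omega) (by omega)
    linarith
  · rw [show T - s - 1 = 0 by omega, range_zero, sum_empty]
    have h1 := hb T le_rfl
    have h2 : (T : ℝ) ≤ s := by exact_mod_cast hs
    linarith

theorem sum_range_le_sum_Icc_one {E : ℕ → ℝ} {T : ℕ} (hE : ∀ t, 1 ≤ t → t ≤ T → 0 ≤ E t)
    (s : ℕ) : ∑ t ∈ range (T - s), E (s + t + 1) ≤ ∑ t ∈ Icc 1 T, E t := by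
  rw [← sum_image (s := range (T - s)) (g := fun t => s + t + 1) (f := E)
    fun a _ b _ hab => by simpa using hab]
  refine sum_le_sum_of_subset_of_nonneg (fun t ht => ?_) fun t ht _ =>
    hE t (mem_Icc.1 ht).1 (mem_Icc.1 ht).2
  obtain ⟨r, hr, rfl⟩ := mem_image.1 ht
  have := mem_range.1 hr
  exact mem_Icc.2 ⟨by omega, by omega⟩

namespace OptHedge

variable {m : ℕ} {n : Fin m → ℕ}

namespace Game.AllPlayOptimisticHedge

variable {G : Game m n} {η : ℝ} {T : ℕ} {x : ℕ → ∀ k, Fin (n k) → ℝ}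

/-- The losses of all players vary little compared to their own variance. -/
theorem sum_variance_le (hx : G.AllPlayOptimisticHedge η T x) (hn : ∀ i, 1 ≤ n i) (hT : 2 ≤ T)
    (hη : 0 < η) (hη' : η * (2000 * m * Real.logb 2 T ^ 4) ≤ 1) (i : Fin m) :
    ∑ t ∈ Icc 1 T, pairCov (x t i) (G.lossVector x i t - G.lossVector x i (t - 1))
        (G.lossVector x i t - G.lossVector x i (t - 1)) ≤
      3 / 32 * ∑ t ∈ Icc 1 T, pairCov (x t i) (G.lossVector x i (t - 1))
        (G.lossVector x i (t - 1)) + 330 * Real.logb 2 T := by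
  set L := Real.logb 2 T with hLdef
  set H := Nat.clog 2 T with hH
  have hHL : (H : ℝ) ≤ 2 * L := clog_two_le_two_mul_logb hT
  have hH0 : 0 < H := Nat.clog_pos (by norm_num) hT
  have hH1 : (1 : ℝ) ≤ H := by exact_mod_cast hH0
  have hL1 : 1 ≤ L := by
    rw [hLdef, Real.le_logb_iff_rpow_le (by norm_num) (by positivity), Real.rpow_one]
    exact_mod_cast hT
  have hm : (1 : ℝ) ≤ m := by exact_mod_cast i.pos
  -- The variance comparison needs the step size only through this square: one logarithm from the
  -- number of rounds in a window, the other from ρ being of order log T.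
  have hηm : η * m * L ^ 2 ≤ 1 / 2000 := by
    have h1 : L ^ 2 ≤ L ^ 4 := pow_le_pow_right₀ hL1 (by norm_num)
    have h2 : η * m * L ^ 2 ≤ η * m * L ^ 4 := by gcongr
    linarith
  have hηL : η * L ≤ 1 / 2000 := by
    refine le_trans ?_ hηm
    rw [mul_assoc]
    refine mul_le_mul_of_nonneg_left ?_ hη.le
    nlinarith
  have hη1 : η ≤ 1 / 2000 := by nlinarith
  set D : ℕ → ℝ := fun t => pairCov (x t i) (G.lossVector x i t - G.lossVector x i (t - 1))
    (G.lossVector x i t - G.lossVector x i (t - 1)) with hD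
  set E : ℕ → ℝ := fun t => pairCov (x t i) (G.lossVector x i (t - 1))
    (G.lossVector x i (t - 1)) with hE
  have hp := fun t (h1 : 1 ≤ t) (h2 : t ≤ T) => (hx i).pos_and_sum_eq_one (hn i) h1 h2
  have hD2 : ∀ t, 1 ≤ t → t ≤ T → D t ≤ 2 := by
    intro t h1 h2
    have hb : ∀ j, |(G.lossVector x i t - G.lossVector x i (t - 1)) j| ≤ 1 := by
      intro j
      have a1 := hx.lossVector_mem hn i h2 j
      have a2 := hx.lossVector_mem hn i (t := t - 1) (by omega) j
      rw [Pi.sub_apply, abs_le]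
      constructor <;> linarith [a1.1, a1.2, a2.1, a2.2]
    have := pairCov_le_sq (fun k => ((hp t h1 h2).1 k).le) (hp t h1 h2).2 hb hb
    linarith [le_of_abs_le this]
  have hE0 : ∀ t, 1 ≤ t → t ≤ T → 0 ≤ E t := fun t h1 h2 =>
    pairCov_self_nonneg (fun k => ((hp t h1 h2).1 k).le) _
  -- The weights run one round ahead of the losses, matching Var(l (t−1)) under the strategy of
  -- round t in the regret bound. Starting at round H + 2 makes differences up to order H + 1
  -- available.
  have hdecay := sum_pairCov_fwdDiff_le_of_decay (P := fun t => x (H + 2 + t + 1) i)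
    (θ := 24 * η) (S := T - (H + 2)) (H := H) hH0
    ((Nat.sub_le _ _).trans (Nat.le_pow_clog (by norm_num) T)) (by positivity)
    (by rw [le_div_iff₀ (by linarith)]; nlinarith)
    (fun t ht k => ((hp _ (by omega) (by omega)).1 k).le)
    (fun t ht => (hp _ (by omega) (by omega)).2)
    (fun t ht => (hx i).abs_pair_sub_le (hn i) hη.le (by linarith) (by omega) (by omega)
      (hx.abs_two_mul_sub_le hn i (by omega)))
    (fun t => G.lossVector x i (t + (H + 2)))
    (by
      intro h hh t ht j
      rw [fwdDiff_iter_apply, fwdDiff_iter_comp_add 1 (fun s => G.lossVector x i s j)]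
      have hs := hx.abs_fwdDiff_iter_lossVector_le hn hη.le (ρ := 8 * (H + 1)) (H := H + 1)
        (by positivity)
        (by
          push_cast
          have h3 : (H : ℝ) + 1 ≤ 3 * L := by linarith
          calc η * (H + 1) * (3 + 6 * (8 * (H + 1))) * (4 * m)
              ≤ η * (3 * L) * (3 * L + 6 * (8 * (3 * L))) * (4 * m) := by
                gcongr; linarith
            _ = 1764 * (η * m * L ^ 2) := by ring
            _ ≤ 1 := by linarith)
        h hh (t + (H + 2)) (by omega) (by omega) i j
      refine hs.trans ?_
      refine mul_le_mul_of_nonneg_left ?_ (by norm_num)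
      rw [div_le_iff₀ (by positivity), ← mul_pow,
        show (1 / 8 : ℝ) * (8 * (H + 1)) = ((H + 1 : ℕ) : ℝ) by push_cast; ring]
      exact_mod_cast (Nat.factorial_le_pow h).trans (Nat.pow_le_pow_left hh h))
  have e1 : ∀ t, pairCov (x (H + 2 + t + 1) i)
      (fwdDiff 1 (fun t => G.lossVector x i (t + (H + 2))) t)
      (fwdDiff 1 (fun t => G.lossVector x i (t + (H + 2))) t) = D (H + 2 + t + 1) := by
    intro t
    have : fwdDiff 1 (fun t => G.lossVector x i (t + (H + 2))) t =
        G.lossVector x i (H + 2 + t + 1) - G.lossVector x i (H + 2 + t + 1 - 1) := by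
      rw [fwdDiff, show t + 1 + (H + 2) = H + 2 + t + 1 by omega,
        show t + (H + 2) = H + 2 + t + 1 - 1 by omega]
    rw [this]
  have e2 : ∀ t, pairCov (x (H + 2 + t + 1) i) (G.lossVector x i (t + (H + 2)))
      (G.lossVector x i (t + (H + 2))) = E (H + 2 + t + 1) := by
    intro t
    rw [show t + (H + 2) = H + 2 + t + 1 - 1 by omega]
  simp only [e1, e2] at hdecay
  have h1 := sum_Icc_one_le_add_sum_range hD2 (H + 2)
  have h2 := sum_range_le_sum_Icc_one hE0 (H + 2)
  push_cast at h1
  linarith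

/-- Since 3/5·3/32 < 2/5, the variances of the losses drop out. What remains is η·(3/5·330) log T =
198 η log T, at most log T. -/
theorem regret_le (hx : G.AllPlayOptimisticHedge η T x) (hn : ∀ i, 1 ≤ n i) (hT : 2 ≤ T)
    (hη : 0 < η) (hη' : η * (2000 * m * Real.logb 2 T ^ 4) ≤ 1) (i : Fin m) :
    G.regret x i T ≤ Real.logb 2 (n i) / η + Real.logb 2 T := by
  have hL1 : 1 ≤ Real.logb 2 T := by
    rw [Real.le_logb_iff_rpow_le (by norm_num) (by positivity), Real.rpow_one]
    exact_mod_cast hT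
  have hm : (1 : ℝ) ≤ m := by exact_mod_cast i.pos
  have hη1 : η ≤ 1 / 2000 := by
    have h1 : (1 : ℝ) ≤ m * Real.logb 2 T ^ 4 := one_le_mul_of_one_le_of_one_le hm
      (one_le_pow₀ hL1)
    nlinarith
  have : Nonempty (Fin (n i)) := ⟨⟨0, hn i⟩⟩
  obtain ⟨j, hj⟩ := exists_eq_ciInf_of_finite (f := fun j => ∑ t ∈ Icc 1 T, G.lossVector x i t j)
  rw [Game.regret, ← hj]
  have hreg := (hx i).regret_le (hn i) hη (by linarith) (by simp [Game.lossVector])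
    (fun t ht j => hx.lossVector_mem hn i ht j) j
  refine hreg.trans ?_
  have hvar := hx.sum_variance_le hn hT hη hη' i
  rw [sum_sub_distrib, ← mul_sum, ← mul_sum]
  set B := ∑ t ∈ Icc 1 T, pairCov (x t i) (G.lossVector x i (t - 1)) (G.lossVector x i (t - 1))
  have hB0 : 0 ≤ B := sum_nonneg fun t ht => pairCov_self_nonneg (fun k =>
    (((hx i).pos_and_sum_eq_one (hn i) (mem_Icc.1 ht).1 (mem_Icc.1 ht).2).1 k).le) _
  have hlog : Real.log (n i) ≤ Real.logb 2 (n i) := by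
    have h0 : 0 ≤ Real.log (n i) := Real.log_natCast_nonneg _
    rw [Real.logb, le_div_iff₀ (Real.log_pos (by norm_num))]
    nlinarith [Real.log_two_lt_d9]
  refine add_le_add (by gcongr) ?_
  calc _ ≤ η * (198 * Real.logb 2 T) := mul_le_mul_of_nonneg_left (by linarith) hη.le
    _ ≤ Real.logb 2 T := by nlinarith

/-- For a single action the bound of part 2 is 0, since log 1 = 0, so the additive log T of the
general estimate cannot be absorbed and this case is treated directly. -/
theorem regret_eq_zero_of_card_eq_one (hx : G.AllPlayOptimisticHedge η T x)
    {i : Fin m} (hni : n i = 1) : G.regret x i T = 0 := by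
  have : Subsingleton (Fin (n i)) := by rw [hni]; infer_instance
  have : Nonempty (Fin (n i)) := ⟨⟨0, by omega⟩⟩
  have j : Fin (n i) := Classical.arbitrary _
  rw [Game.regret]
  have hinf : ⨅ j, ∑ t ∈ Icc 1 T, G.lossVector x i t j = ∑ t ∈ Icc 1 T, G.lossVector x i t j := by
    have : ∀ k, ∑ t ∈ Icc 1 T, G.lossVector x i t k = ∑ t ∈ Icc 1 T, G.lossVector x i t j :=
      fun k => by rw [Subsingleton.elim k j]
    simp_rw [this]
    exact ciInf_const
  rw [hinf, sub_eq_zero]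
  refine sum_congr rfl fun t ht => ?_
  have hs := ((hx i).pos_and_sum_eq_one hni.ge (mem_Icc.1 ht).1 (mem_Icc.1 ht).2).2
  calc ∑ k, x t i k * G.lossVector x i t k = ∑ k, x t i k * G.lossVector x i t j :=
        sum_congr rfl fun k _ => by rw [Subsingleton.elim k j]
    _ = _ := by rw [← sum_mul, hs, one_mul]

/-- Small regrets of all players make the empirical distribution of play an approximate coarse
correlated equilibrium. -/
theorem isApproxCCE_empiricalPlay (hx : G.AllPlayOptimisticHedge η T x) (hn : ∀ i, 1 ≤ n i)
    (hT : 1 ≤ T) {r : ℝ} (hr : ∀ i, G.regret x i T ≤ r) :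
    G.IsApproxCCE (r / T) (empiricalPlay x T) := by
  have hp := fun i t (ht : t ∈ Icc 1 T) =>
    (hx i).pos_and_sum_eq_one (hn i) (mem_Icc.1 ht).1 (mem_Icc.1 ht).2
  have hT0 : (0 : ℝ) < T := by exact_mod_cast hT
  -- Expectations under the empirical distribution are averages over rounds of expectations under
  -- product distributions. This reduces both the total mass and the equilibrium inequality to
  -- single rounds.
  have hexch : ∀ F : (∀ k, Fin (n k)) → ℝ, ∑ a, empiricalPlay x T a * F a =
      1 / (T : ℝ) * ∑ t ∈ Icc 1 T, ∑ a : (∀ k, Fin (n k)), (∏ k, x t k (a k)) * F a := by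
    intro F
    simp_rw [empiricalPlay, mul_assoc, sum_mul]
    rw [← mul_sum, sum_comm]
  refine ⟨⟨fun a => ?_, ?_⟩, fun i j => ?_⟩
  · exact mul_nonneg (by positivity) (sum_nonneg fun t ht => prod_nonneg fun k _ =>
      ((hp k t ht).1 _).le)
  · have h1 := hexch fun _ => 1
    simp only [mul_one] at h1
    rw [h1]
    have h2 : ∀ t ∈ Icc 1 T, ∑ a : (∀ k, Fin (n k)), ∏ k, x t k (a k) = 1 := by
      intro t ht
      rw [← Fintype.piFinset_univ, ← prod_univ_sum]
      exact prod_eq_one fun k _ => (hp k t ht).2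
    rw [sum_congr rfl h2, sum_const, Nat.card_Icc, nsmul_eq_mul, Nat.add_sub_cancel, mul_one,
      one_div_mul_cancel hT0.ne']
  · rw [hexch, hexch]
    have hl : ∀ t ∈ Icc 1 T, G.lossVector x i t = G.expectedLoss (x t) i := fun t ht => by
      rw [Game.lossVector, if_neg (by have := mem_Icc.1 ht; omega)]
    have e1 : ∑ t ∈ Icc 1 T, ∑ a : (∀ k, Fin (n k)), (∏ k, x t k (a k)) * G.loss i a =
        ∑ t ∈ Icc 1 T, ∑ k, x t i k * G.lossVector x i t k :=
      sum_congr rfl fun t ht => by rw [G.sum_prod_mul_loss, hl t ht]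
    have e2 : ∑ t ∈ Icc 1 T, ∑ a : (∀ k, Fin (n k)),
        (∏ k, x t k (a k)) * G.loss i (Function.update a i j) =
        ∑ t ∈ Icc 1 T, G.lossVector x i t j :=
      sum_congr rfl fun t ht => by
        rw [G.sum_prod_mul_loss_update i (hp i t ht).2, hl t ht]
    rw [e1, e2]
    have hreg := hr i
    rw [Game.regret] at hreg
    have hinf : ⨅ j, ∑ t ∈ Icc 1 T, G.lossVector x i t j ≤ ∑ t ∈ Icc 1 T, G.lossVector x i t j :=
      ciInf_le (Set.finite_range _).bddBelow j
    rw [div_eq_mul_one_div r, mul_comm r, ← mul_add]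
    exact mul_le_mul_of_nonneg_left (by linarith) (by positivity)

end Game.AllPlayOptimisticHedge

end OptHedge

/-! ### The theorem -/

theorem theorem3p1 :
    ∃ C C' K : ℝ, 1 < C ∧ 1 < C' ∧ 0 < K ∧
      ∀ (m : ℕ) (n : Fin m → ℕ) (_hn : ∀ i, 1 ≤ n i) (G : OptHedge.Game m n)
        (T : ℕ) (_hT : 2 ≤ T) (x : ℕ → ∀ k, Fin (n k) → ℝ),
        (∀ η : ℝ, 0 < η → η ≤ 1 / (C * m * Real.logb 2 T ^ 4) →
          G.AllPlayOptimisticHedge η T x →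
          ∀ i, G.regret x i T ≤ Real.logb 2 (n i) / η + C' * Real.logb 2 T) ∧
        (G.AllPlayOptimisticHedge (1 / (C * m * Real.logb 2 T ^ 4)) T x →
          (∀ i, G.regret x i T ≤ K * (m * Real.logb 2 (n i) * Real.logb 2 T ^ 4)) ∧
          ∀ N : ℕ, (∀ i, n i ≤ N) →
            G.IsApproxCCE (K * (m * Real.logb 2 N * Real.logb 2 T ^ 4) / T)
              (OptHedge.empiricalPlay x T)) := by
  -- C = 2000 exceeds the constants 1764 (smoothness) and 1680 (drift of the weights) met in the
  -- variance comparison. C' = 2 has slack, since coefficient 1 is proved; K = C + 1 because log T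
  -- is absorbed when n i ≥ 2.
  refine ⟨2000, 2, 2001, by norm_num, by norm_num, by norm_num, ?_⟩
  intro m n hn G T hT x
  have hL1 : 1 ≤ Real.logb 2 T := by
    rw [Real.le_logb_iff_rpow_le (by norm_num) (by positivity), Real.rpow_one]
    exact_mod_cast hT
  -- Positivity of m comes from the existence of a player; for m = 0 the claims about players are
  -- vacuous.
  have hden : ∀ i : Fin m, 0 < 2000 * (m : ℝ) * Real.logb 2 T ^ 4 := fun i => by
    have : (0 : ℝ) < m := by exact_mod_cast i.pos
    positivity
  refine ⟨fun η hη hη' hx i => ?_, fun hx => ?_⟩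
  · have h1 := hx.regret_le hn hT hη ((le_div_iff₀ (hden i)).1 hη') i
    linarith
  have hreg : ∀ i, G.regret x i T ≤ 2001 * (m * Real.logb 2 (n i) * Real.logb 2 T ^ 4) := by
    intro i
    rcases (hn i).eq_or_lt with h1 | h2
    · rw [hx.regret_eq_zero_of_card_eq_one h1.symm, ← h1]
      simp
    · have hni : 1 ≤ Real.logb 2 (n i) := by
        rw [Real.le_logb_iff_rpow_le (by norm_num) (by positivity), Real.rpow_one]
        exact_mod_cast h2
      have hm : (1 : ℝ) ≤ m := by exact_mod_cast i.pos
      have h3 := hx.regret_le hn hT (one_div_pos.2 (hden i))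
        (one_div_mul_cancel (hden i).ne').le i
      rw [div_div_eq_mul_div, div_one] at h3
      have h4 : Real.logb 2 T ≤ m * Real.logb 2 (n i) * Real.logb 2 T ^ 4 := by
        calc Real.logb 2 T = 1 * 1 * Real.logb 2 T ^ 1 := by ring
          _ ≤ m * Real.logb 2 (n i) * Real.logb 2 T ^ 4 := by
            gcongr
            norm_num
      linarith
  refine ⟨hreg, fun N hN => ?_⟩
  refine hx.isApproxCCE_empiricalPlay hn (by omega) fun i => (hreg i).trans ?_
  have hni : (0 : ℝ) < n i := by exact_mod_cast hn i
  have hNi : (n i : ℝ) ≤ N := by exact_mod_cast hN i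
  have hlog : Real.logb 2 (n i) ≤ Real.logb 2 N :=
    Real.logb_le_logb_of_le (by norm_num) hni hNi
  gcongr
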